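/- Let $d\in\mathbb N$. Points of phase space $\mathbb R^{d}\times\mathbb R^{d}=\mathbb R^{2d}$ are written $z=(q,p)$, and $|\cdot|$ is the Euclidean norm. Let $\kappa=(X^\kappa,\Xi^\kappa)$ be a canonical transformation of class $\mathcal B$: a smooth diffeomorphism of $\mathbb R^{2d}$ with smooth inverse whose Jacobian matrix $F^\kappa(z)$ is symplectic for every $z$ and such that $M^\kappa_k:=\max_{|\alpha|=k}\sup_{z}|\partial^\alpha F^\kappa(z)|<\infty$ for every $k\ge 0$. Let $S^\kappa:\mathbb R^{2d}\to\mathbb R$ be an action associated to $\kappa$, i.e. a differentiable function with $$\partial_{q_j}S^\kappa=-p_j+\sum_k(\partial_{q_j}X^\kappa_k)\,\Xi^\kappa_k,\qquad \partial_{p_j}S^\kappa=\sum_k(\partial_{p_j}X^\kappa_k)\,\Xi^\kappa_k .$$ Let $\Theta^x,\Theta^y$ be complex symmetric $d\times d$ matrices with positive definite real part. For such a matrix $\Theta$ put $$\Lambda(\Theta)=\begin{pmatrix}(\Re\Theta)^{1/2}&0\\(\Re\Theta)^{-1/2}\Im\Theta&(\Re\Theta)^{-1/2}\end{pmatrix}.$$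 For $0<\varepsilon\le1$ and $u\in C_c^\infty(\mathbb R^{2d};\mathbb C)$ let $\mathcal I^\varepsilon_u$ be the operator on Schwartz functions with integral kernel $$K^\varepsilon_u(x,y)=\frac1{(2\pi\varepsilon)^{3d/2}}\int_{\mathbb R^{2d}}e^{\frac i\varepsilon\Phi^\kappa(x,y,q,p)}u(q,p)\,dq\,dp,$$ $$\Phi^\kappa=S^\kappa(q,p)+\Xi^\kappa\cdot(x-X^\kappa)-p\cdot(y-q)+\tfrac i2(x-X^\kappa)\cdot\Theta^x(x-X^\kappa)+\tfrac i2(y-q)\cdot\Theta^y(y-q),$$ where $X^\kappa,\Xi^\kappa$ are taken at $(q,p)$. For a map $f$ of $\mathbb R^{2d}$ and sets $K,L\subset\mathbb R^{2d}$ put $\delta_f[K,L]=\inf\{|a-b|:a\in f(K),\,b\in f(L)\}$. Finally, put $\|w\|_{W^{m,\infty}}=\sum_{|\alpha|\le m}\|\partial^\alpha w\|_{L^\infty}$. Let $u,v\in C_c^\infty(\mathbb R^{2d};\mathbb C)$ have supports $K_u,K_v$. Then $\mathcal I^\varepsilon_u$ and $\mathcal I^\varepsilon_v$ extend uniquely to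 bounded operators on $L^2(\mathbb R^d;\mathbb C)$, with norms bounded independently of $\varepsilon\in(0,1]$. More precisely: (i) There is a constant $C>0$ depending only on $d$ such that for all $0<\varepsilon\le1$ $$\|(\mathcal I^\varepsilon_v)^*\mathcal I^\varepsilon_u\|_{L^2\to L^2}\le C\,\frac{e^{-\delta_{\Lambda(\Theta^x)\circ\kappa}[K_u,K_v]^2/(4\varepsilon)}\,\|u\|_{L^1}\|v\|_{L^1}}{\varepsilon^{2d}(\det\Re\Theta^x\,\det\Re\Theta^y)^{1/2}},$$ $$\|\mathcal I^\varepsilon_v(\mathcal I^\varepsilon_u)^*\|_{L^2\to L^2}\le C\,\frac{e^{-\delta_{\Lambda(\overline{\Theta^y})}[K_u,K_v]^2/(4\varepsilon)}\,\|u\|_{L^1}\|v\|_{L^1}}{\varepsilon^{2d}(\det\Re\Theta^x\,\det\Re\Theta^y)^{1/2}}.$$ (ii) There is a constant $C'>0$, depending only on $d$, on $M^\kappa_k$ for $k\le d+2$, on $\|\Lambda(\Theta^x)\|$, $\|\Lambda(\Theta^y)\|$, $\|\Lambda(\Theta^x)^{-1}\|$, $\|\Lambda(\Theta^y)^{-1}\|$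 and on $r_\infty$, such that, whenever $K_u\cup K_v$ is contained in a ball of radius $r$ with $0<r\le r_\infty$, for all $0<\varepsilon\le1$ $$\|(\mathcal I^\varepsilon_v)^*\mathcal I^\varepsilon_u\|_{L^2\to L^2}+\|\mathcal I^\varepsilon_v(\mathcal I^\varepsilon_u)^*\|_{L^2\to L^2}\le C'\,r^d\,\frac{\|u\|_{W^{d+1,\infty}}\|v\|_{W^{d+1,\infty}}}{(\det\Re\Theta^x\,\det\Re\Theta^y)^{1/2}} .$$ -/

import Mathlib

open scoped ContDiff MatrixOrder Matrix

namespace CplxPhaseOp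

noncomputable section

/-- Configuration space `ℝ^d` with its Euclidean norm. -/
abbrev Pos (d : ℕ) : Type := EuclideanSpace ℝ (Fin d)

/-- Phase space `ℝ^d × ℝ^d` with the Euclidean norm of `ℝ^{2d}`. The coordinates of `z = (q, p)` are
`q_j = z (Sum.inl j)` and `p_j = z (Sum.inr j)`. -/
abbrev Phase (d : ℕ) : Type := EuclideanSpace ℝ (Fin d ⊕ Fin d)

/-- The Hilbert space `L²(ℝ^d; ℂ)`. -/
abbrev L2 (d : ℕ) : Type := MeasureTheory.Lp ℂ 2 (MeasureTheory.volume : MeasureTheory.Measure (Pos d))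

section Derivatives

variable {d : ℕ} {F : Type*} [NormedAddCommGroup F] [NormedSpace ℝ F]

/-- The partial derivative of a function on phase space with respect to the coordinate `j`. -/
def pderiv (j : Fin d ⊕ Fin d) (f : Phase d → F) : Phase d → F :=
  fun z => fderiv ℝ f z (EuclideanSpace.single j 1)

/-- The partial derivative `∂^α_{(q,p)} f` for a multi-index `α` on the `2d` coordinates. -/
def multiDeriv (α : Fin d ⊕ Fin d → ℕ) (f : Phase d → F) : Phase d → F :=
  ((List.finRange d).map Sum.inl ++ (List.finRange d).map Sum.inr).foldr
    (fun j g => (pderiv j)^[α j] g) f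

/-- The norm `‖w‖_{W^{m,∞}} = ∑_{|α| ≤ m} sup |∂^α w|`. -/
def sobolevNorm (m : ℕ) (w : Phase d → F) : ℝ :=
  ∑ k ∈ Finset.range (m + 1), ∑ α ∈ Finset.piAntidiag (Finset.univ : Finset (Fin d ⊕ Fin d)) k,
    ⨆ z, ‖multiDeriv α w z‖

end Derivatives

section Canonical

variable {d : ℕ}

/-- The Jacobian matrix `F^κ(z)`, with entry `∂_j κ_i` in row `i` and column `j`. -/
def jacobian (κ : Phase d → Phase d) (z : Phase d) : Matrix (Fin d ⊕ Fin d) (Fin d ⊕ Fin d) ℝ :=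
  Matrix.of fun i j => pderiv j κ z i

/-- The standard symplectic matrix. -/
def symplJ (d : ℕ) : Matrix (Fin d ⊕ Fin d) (Fin d ⊕ Fin d) ℝ := Matrix.fromBlocks 0 1 (-1) 0

/-- Canonical transformations: smooth diffeomorphisms of phase space with symplectic Jacobian. -/
structure IsCanonical (κ : Phase d → Phase d) : Prop where
  smooth : ContDiff ℝ ∞ κ
  smooth_inv : ∃ κinv : Phase d → Phase d, ContDiff ℝ ∞ κinv ∧
    Function.LeftInverse κinv κ ∧ Function.RightInverse κinv κ
  symplectic : ∀ z, (jacobian κ z)ᵀ * symplJ d * jacobian κ z = symplJ d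

/-- `|∂^α F^κ(z)|`, with the Hilbert (Frobenius) norm of the matrix. -/
def jacobianDerivNorm (κ : Phase d → Phase d) (α : Fin d ⊕ Fin d → ℕ) (z : Phase d) : ℝ :=
  √(∑ i, ∑ j, (multiDeriv α (fun z' => jacobian κ z' i j) z) ^ 2)

/-- Canonical transformations of class `𝓑`: all derivatives of the Jacobian are bounded. -/
structure IsClassB (κ : Phase d → Phase d) : Prop extends IsCanonical κ where
  bounded : ∀ α : Fin d ⊕ Fin d → ℕ, BddAbove (Set.range (jacobianDerivNorm κ α))

/-- `M^κ_k = max_{|α| = k} sup_z |∂^α F^κ(z)|`. -/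
def boundM (κ : Phase d → Phase d) (k : ℕ) : ℝ :=
  ⨆ α : {α // α ∈ Finset.piAntidiag (Finset.univ : Finset (Fin d ⊕ Fin d)) k},
    ⨆ z, jacobianDerivNorm κ α.1 z

/-- `S` is an action associated to `κ = (X, Ξ)`:
`S_q = -p + X_q Ξ` and `S_p = X_p Ξ`, where `(X_q)_{jk} = ∂_{q_j} X_k`. -/
structure IsAction (κ : Phase d → Phase d) (S : Phase d → ℝ) : Prop where
  differentiable : Differentiable ℝ S
  deriv_q : ∀ z (j : Fin d), pderiv (Sum.inl j) S z =
    -z (Sum.inr j) + ∑ k : Fin d, pderiv (Sum.inl j) κ z (Sum.inl k) * κ z (Sum.inr k)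
  deriv_p : ∀ z (j : Fin d), pderiv (Sum.inr j) S z =
    ∑ k : Fin d, pderiv (Sum.inr j) κ z (Sum.inl k) * κ z (Sum.inr k)

end Canonical

section Widths

variable {d : ℕ}

/-- Entrywise real part. -/
def reMat (Θ : Matrix (Fin d) (Fin d) ℂ) : Matrix (Fin d) (Fin d) ℝ := Θ.map Complex.re

/-- Entrywise imaginary part. -/
def imMat (Θ : Matrix (Fin d) (Fin d) ℂ) : Matrix (Fin d) (Fin d) ℝ := Θ.map Complex.im

/-- Entrywise complex conjugate. -/
def conjMat (Θ : Matrix (Fin d) (Fin d) ℂ) : Matrix (Fin d) (Fin d) ℂ := Θ.map (starRingEnd ℂ)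

/-- Complex symmetric matrices with positive definite real part. -/
structure IsWidth (Θ : Matrix (Fin d) (Fin d) ℂ) : Prop where
  symm : Θ.IsSymm
  posDef : (reMat Θ).PosDef

/-- The symplectic matrix `Λ(Θ)` with blocks `(Re Θ)^{1/2}`, `0`,
`(Re Θ)^{-1/2} Im Θ`, `(Re Θ)^{-1/2}`. -/
def Lam (Θ : Matrix (Fin d) (Fin d) ℂ) : Matrix (Fin d ⊕ Fin d) (Fin d ⊕ Fin d) ℝ :=
  Matrix.fromBlocks (CFC.sqrt (reMat Θ)) 0
    ((CFC.sqrt (reMat Θ))⁻¹ * imMat Θ) (CFC.sqrt (reMat Θ))⁻¹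

/-- `Λ(Θ)` as a linear map of phase space. -/
def LamMap (Θ : Matrix (Fin d) (Fin d) ℂ) : Phase d →L[ℝ] Phase d :=
  Matrix.toEuclideanCLM (𝕜 := ℝ) (Lam Θ)

/-- `Λ(Θ)⁻¹` as a linear map of phase space. -/
def LamInvMap (Θ : Matrix (Fin d) (Fin d) ℂ) : Phase d →L[ℝ] Phase d :=
  Matrix.toEuclideanCLM (𝕜 := ℝ) (Lam Θ)⁻¹

/-- `δ_f[K, L] = inf {|a - b| : a ∈ f(K), b ∈ f(L)}`. -/
def sepDist (f : Phase d → Phase d) (K L : Set (Phase d)) : ℝ :=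
  sInf {t | ∃ a ∈ f '' K, ∃ b ∈ f '' L, t = ‖a - b‖}

end Widths

section Operators

variable {d : ℕ}

/-- The complex number `w · Θ w` for a real vector `w`. -/
def quad (Θ : Matrix (Fin d) (Fin d) ℂ) (w : Fin d → ℝ) : ℂ :=
  ∑ i, ∑ j, (w i : ℂ) * Θ i j * (w j : ℂ)

/-- The complex phase `Φ^κ(x, y, q, p; Θ^x, Θ^y)` with `z = (q, p)`. -/
def phase (κ : Phase d → Phase d) (S : Phase d → ℝ) (Θx Θy : Matrix (Fin d) (Fin d) ℂ)
    (x y : Pos d) (z : Phase d) : ℂ :=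
  ((S z + ∑ i : Fin d, κ z (Sum.inr i) * (x i - κ z (Sum.inl i))
      - ∑ i : Fin d, z (Sum.inr i) * (y i - z (Sum.inl i)) : ℝ) : ℂ)
    + Complex.I / 2 * quad Θx (fun i => x i - κ z (Sum.inl i))
    + Complex.I / 2 * quad Θy (fun i => y i - z (Sum.inl i))

/-- The kernel `K^ε(κ; u; Θ^x, Θ^y)(x, y)` for an `(x, y)`-independent symbol `u`. -/
def kernel (ε : ℝ) (κ : Phase d → Phase d) (S : Phase d → ℝ) (Θx Θy : Matrix (Fin d) (Fin d) ℂ)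
    (u : Phase d → ℂ) (x y : Pos d) : ℂ :=
  (((2 * Real.pi * ε) ^ (-(3 * (d : ℝ) / 2)) : ℝ) : ℂ) *
    ∫ z : Phase d, Complex.exp (Complex.I / (ε : ℂ) * phase κ S Θx Θy x y z) * u z

/-- The Fourier integral operator with kernel `K^ε(κ; u; Θ^x, Θ^y)` acting on Schwartz functions. -/
def fio (ε : ℝ) (κ : Phase d → Phase d) (S : Phase d → ℝ) (Θx Θy : Matrix (Fin d) (Fin d) ℂ)
    (u : Phase d → ℂ) (φ : SchwartzMap (Pos d) ℂ) (x : Pos d) : ℂ :=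
  ∫ y : Pos d, kernel ε κ S Θx Θy u x y * φ y

/-- The bounded operator `A` on `L²(ℝ^d; ℂ)` extends `T`, which is defined on Schwartz functions. -/
def ExtendsToL2 (T : SchwartzMap (Pos d) ℂ → Pos d → ℂ) (A : L2 d →L[ℂ] L2 d) : Prop :=
  ∀ φ : SchwartzMap (Pos d) ℂ, (A (φ.toLp 2) : Pos d → ℂ) =ᵐ[MeasureTheory.volume] T φ

/-- `𝓝 = ‖B^* A‖ + ‖B A^*‖`. -/
def crossNorm (A B : L2 d →L[ℂ] L2 d) : ℝ :=
  ‖ContinuousLinearMap.adjoint B ∘L A‖ + ‖B ∘L ContinuousLinearMap.adjoint A‖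

end Operators

end

end CplxPhaseOp

/-! The phase splits: exp(iΦ/ε) is exp(iS/ε) times a Gaussian packet in `x` centred at κ(z), of
width Θ^x, times the conjugate of a packet in `y` centred at z, of width conj Θ^y (`exp_phase`). So
the operator is a superposition over z of rank-one operators, and everything reduces to the overlaps
of packets of equal width. These are explicit: up to a unimodular factor, ⟨g_w, g_z⟩ is the packet
mass times exp(-|Λ(Θ)(z - w)|²/(4ε)).

For (i), the composition I_v^* I_u contains overlaps of `x`-packets only between points of the two
supports, so the exponential is at most its value at the separation distance. Integrating absolute
values gives the two L¹ norms (`norm_adjoint_frameOp_comp_le`). Taking adjoints exchanges the two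
packet families and gives the other composition.

For (ii), Schur's test on the overlaps bounds each operator. Since κ and Λ preserve volume, the
Schur constant is a Gaussian integral, and all powers of ε cancel: ‖I_u‖ is at most a constant times
sup |u| (`norm_packetOp_le`). The factor r^d then comes from `u` alone: a function supported in a
ball of radius r is bounded by (3r)^d times the supremum of a d-th derivative
(`norm_le_pow_mul_sobolevNorm`). -/

namespace CplxPhaseOp

noncomputable section

/-! ### Superpositions of rank-one operators over a compact set -/

section FrameOperators

open MeasureTheory InnerProductSpace ComplexConjugate

variable {Z H : Type*} [MetricSpace Z] [ProperSpace Z] [MeasurableSpace Z] [BorelSpace Z]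
  {μ : Measure Z} [IsLocallyFiniteMeasure μ]
  [NormedAddCommGroup H] [InnerProductSpace ℂ H]
  {K : Set Z} {α β : Z → ℂ} {g h : Z → H}

lemma integrableOn_of_continuous {E : Type*} [NormedAddCommGroup E] (hK : IsCompact K)
    {f : Z → E} (hf : Continuous f) : IntegrableOn f K μ :=
  hf.continuousOn.integrableOn_compact hK

lemma integrableOn_smul (hK : IsCompact K) (hα : Continuous α) (hg : Continuous g) :
    IntegrableOn (fun z => α z • g z) K μ :=
  integrableOn_of_continuous hK (by fun_prop)

variable [CompleteSpace H]

lemma norm_inner_setIntegral_smul_le (hK : IsCompact K) (hα : Continuous α) (hg : Continuous g)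
    (x : H) :
    ‖⟪∫ z in K, α z • g z ∂μ, x⟫_ℂ‖ ≤ ∫ z in K, ‖α z‖ * ‖⟪g z, x⟫_ℂ‖ ∂μ := by
  rw [norm_inner_symm, ← integral_inner (integrableOn_smul hK hα hg)]
  refine (norm_integral_le_integral_norm _).trans (le_of_eq ?_)
  congr 1 with z
  rw [inner_smul_right, norm_mul, norm_inner_symm]

/-- Schur's test for synthesis operators. -/
lemma norm_setIntegral_smul_sq_le (hK : IsCompact K) (hα : Continuous α) (hg : Continuous g)
    {C : ℝ} (hC : ∀ z, ∫ w in K, ‖⟪g w, g z⟫_ℂ‖ ∂μ ≤ C) :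
    ‖∫ z in K, α z • g z ∂μ‖ ^ 2 ≤ C * ∫ z in K, ‖α z‖ ^ 2 ∂μ := by
  set k : Z → Z → ℝ := fun z w => ‖⟪g w, g z⟫_ℂ‖ with hk
  have hkc : Continuous (Function.uncurry k) := by
    simp only [hk, Function.uncurry_def]; fun_prop
  have hksymm : ∀ z w, k z w = k w z := fun z w => norm_inner_symm _ _
  have hpar : ∀ F : Z → Z → ℝ, Continuous (Function.uncurry F) →
      Continuous fun z => ∫ w in K, F z w ∂μ := fun F hF =>
    continuous_parametric_integral_of_continuous hF hK
  have hsec : ∀ F : Z → Z → ℝ, Continuous (Function.uncurry F) → ∀ z, Continuous (F z) :=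
    fun F hF z => hF.comp (by fun_prop : Continuous fun w => (z, w))
  have h1 : ‖∫ z in K, α z • g z ∂μ‖ ^ 2 ≤
      ∫ z in K, ∫ w in K, ‖α z‖ * (‖α w‖ * k z w) ∂μ ∂μ := by
    have : ‖∫ z in K, α z • g z ∂μ‖ ^ 2 =
        ‖⟪∫ z in K, α z • g z ∂μ, ∫ z in K, α z • g z ∂μ⟫_ℂ‖ := by
      rw [inner_self_eq_norm_sq_to_K]; simp
    rw [this]
    refine (norm_inner_setIntegral_smul_le hK hα hg _).trans ?_
    refine setIntegral_mono (integrableOn_of_continuous hK (by fun_prop))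
      (integrableOn_of_continuous hK (hpar (fun z w => ‖α z‖ * (‖α w‖ * k z w)) ?_)) fun z => ?_
    · simp only [Function.uncurry_def] at hkc ⊢; fun_prop
    · dsimp only
      rw [integral_const_mul, norm_inner_symm]
      gcongr
      exact norm_inner_setIntegral_smul_le hK hα hg _
  have hA : Continuous (Function.uncurry fun z w => ‖α z‖ ^ 2 * k z w) := by
    simp only [Function.uncurry_def] at hkc ⊢; fun_prop
  have hB : Continuous (Function.uncurry fun z w => ‖α w‖ ^ 2 * k z w) := by
    simp only [Function.uncurry_def] at hkc ⊢; fun_prop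
  -- The inequality 2ab ≤ a² + b², weighted by the nonnegative kernel `k`. By symmetry of `k` and
  -- Fubini the two resulting terms are equal, so one Schur bound suffices.
  have h2 : ∫ z in K, ∫ w in K, ‖α z‖ * (‖α w‖ * k z w) ∂μ ∂μ ≤
      ∫ z in K, ((∫ w in K, ‖α z‖ ^ 2 * k z w ∂μ) + ∫ w in K, ‖α w‖ ^ 2 * k z w ∂μ) / 2 ∂μ := by
    refine setIntegral_mono
      (integrableOn_of_continuous hK (hpar (fun z w => ‖α z‖ * (‖α w‖ * k z w)) ?_))
      (integrableOn_of_continuous hK (((hpar _ hA).add (hpar _ hB)).div_const 2)) fun z => ?_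
    · simp only [Function.uncurry_def] at hkc ⊢; fun_prop
    · dsimp only
      rw [← integral_add (integrableOn_of_continuous hK (hsec _ hA z))
        (integrableOn_of_continuous hK (hsec _ hB z)), ← integral_div]
      have hkz := hsec _ hkc z
      refine setIntegral_mono (integrableOn_of_continuous hK (by fun_prop))
        (integrableOn_of_continuous hK (by fun_prop)) fun w => ?_
      have : 0 ≤ k z w := norm_nonneg _
      dsimp only
      nlinarith [mul_nonneg this (sq_nonneg (‖α z‖ - ‖α w‖))]
  have h3 : ∫ z in K, ∫ w in K, ‖α w‖ ^ 2 * k z w ∂μ ∂μ =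
      ∫ z in K, ∫ w in K, ‖α z‖ ^ 2 * k z w ∂μ ∂μ := by
    rw [integral_integral_swap]
    · simp_rw [hksymm]
    · rw [Measure.prod_restrict]
      exact integrableOn_of_continuous (hK.prod hK) hB
  have h4 : ∫ z in K, ∫ w in K, ‖α z‖ ^ 2 * k z w ∂μ ∂μ ≤ C * ∫ z in K, ‖α z‖ ^ 2 ∂μ := by
    rw [← integral_const_mul]
    refine setIntegral_mono (integrableOn_of_continuous hK (hpar _ hA))
      (integrableOn_of_continuous hK (by fun_prop)) fun z => ?_
    dsimp only
    rw [integral_const_mul, mul_comm]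
    gcongr
    exact hC z
  rw [integral_div, integral_add (integrableOn_of_continuous hK (hpar _ hA))
    (integrableOn_of_continuous hK (hpar _ hB)), h3] at h2
  linarith

/-- Bessel's inequality for a continuous family satisfying Schur's condition. -/
lemma setIntegral_norm_inner_sq_le (hK : IsCompact K) (hg : Continuous g)
    {C : ℝ} (hC0 : 0 ≤ C) (hC : ∀ z, ∫ w in K, ‖⟪g w, g z⟫_ℂ‖ ∂μ ≤ C) (φ : H) :
    ∫ z in K, ‖⟪g z, φ⟫_ℂ‖ ^ 2 ∂μ ≤ C * ‖φ‖ ^ 2 := by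
  set X := ∫ z in K, ‖⟪g z, φ⟫_ℂ‖ ^ 2 ∂μ with hX
  set G := ∫ z in K, ⟪g z, φ⟫_ℂ • g z ∂μ with hG
  have hc : Continuous fun z => ⟪g z, φ⟫_ℂ := by fun_prop
  have hX0 : 0 ≤ X := integral_nonneg fun z => by positivity
  -- With the coefficients ⟨g_z, φ⟩ the right side of Schur's test is `X` itself. As `X` = ⟨φ, G⟩
  -- too, Cauchy–Schwarz gives X² ≤ C‖φ‖²X, and `X` can be cancelled unless it vanishes.
  have hGX : ‖G‖ ^ 2 ≤ C * X := norm_setIntegral_smul_sq_le hK hc hg hC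
  have h1 : (X : ℂ) = ⟪φ, G⟫_ℂ := by
    rw [hG, ← integral_inner (integrableOn_smul hK hc hg), hX, ← integral_complex_ofReal]
    congr 1 with z
    rw [inner_smul_right, ← inner_conj_symm φ (g z), Complex.mul_conj, Complex.normSq_eq_norm_sq]
  have h2 : X ≤ ‖φ‖ * ‖G‖ := by
    have := norm_inner_le_norm (𝕜 := ℂ) φ G
    rwa [← h1, Complex.norm_real, Real.norm_of_nonneg hX0] at this
  have h3 : X * X ≤ C * ‖φ‖ ^ 2 * X := by
    nlinarith [mul_self_le_mul_self hX0 h2, mul_le_mul_of_nonneg_left hGX (sq_nonneg ‖φ‖)]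
  rcases hX0.eq_or_lt with h0 | h0
  · rw [← h0]; positivity
  · exact le_of_mul_le_mul_right h3 h0

variable (μ K α g h) in
/-- The superposition `∫_K α(z) |g_z⟩⟨h_z| dμ(z)` of rank-one operators. -/
def frameOp : H →L[ℂ] H := ∫ z in K, α z • rankOne ℂ (g z) (h z) ∂μ

lemma integrableOn_rankOne (hK : IsCompact K) (hα : Continuous α) (hg : Continuous g)
    (hh : Continuous h) : IntegrableOn (fun z => α z • rankOne ℂ (g z) (h z)) K μ :=
  integrableOn_of_continuous hK (hα.smul ((ContinuousLinearMap.smulRightL ℂ H H).continuous₂.comp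
    (((innerSL ℂ).continuous.comp hh).prodMk hg)))

lemma frameOp_apply (hK : IsCompact K) (hα : Continuous α) (hg : Continuous g)
    (hh : Continuous h) (φ : H) :
    frameOp μ K α g h φ = ∫ z in K, (α z * ⟪h z, φ⟫_ℂ) • g z ∂μ := by
  rw [frameOp, ContinuousLinearMap.integral_apply (integrableOn_rankOne hK hα hg hh)]
  simp [mul_smul]

lemma adjoint_frameOp (hK : IsCompact K) (hα : Continuous α) (hg : Continuous g)
    (hh : Continuous h) :
    ContinuousLinearMap.adjoint (frameOp μ K α g h) = frameOp μ K (fun z => conj (α z)) h g := by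
  symm
  rw [ContinuousLinearMap.eq_adjoint_iff]
  intro x y
  have hα' : Continuous fun z => conj (α z) := by fun_prop
  rw [frameOp_apply hK hα hg hh, frameOp_apply hK hα' hh hg,
    ← integral_inner (integrableOn_smul hK (by fun_prop) hg), ← inner_conj_symm,
    ← integral_inner (integrableOn_smul hK (by fun_prop) hh), ← integral_conj]
  congr 1 with z
  simp only [inner_smul_right, map_mul, inner_conj_symm, Complex.conj_conj]
  ring

lemma norm_adjoint_frameOp_apply_le (hK : IsCompact K) (hβ : Continuous β) (hg : Continuous g)
    (hh : Continuous h) {N : ℝ} (hN : ∀ z, ‖h z‖ = N) (x : H) :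
    ‖ContinuousLinearMap.adjoint (frameOp μ K β g h) x‖ ≤
      ∫ w in K, ‖β w‖ * ‖⟪g w, x⟫_ℂ‖ * N ∂μ := by
  rw [adjoint_frameOp hK hβ hg hh, frameOp_apply hK (by fun_prop) hh hg]
  refine (norm_integral_le_integral_norm _).trans (le_of_eq ?_)
  congr 1 with w
  rw [norm_smul, norm_mul, hN, RCLike.norm_conj]

/-- Almost orthogonality of superpositions of rank-one operators. -/
lemma norm_adjoint_frameOp_comp_le (hK : IsCompact K) (hα : Continuous α) (hβ : Continuous β)
    (hg : Continuous g) (hh : Continuous h) {N E : ℝ} (hN : ∀ z, ‖h z‖ = N) (hE0 : 0 ≤ E)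
    (hE : ∀ z w, α z ≠ 0 → β w ≠ 0 → ‖⟪g w, g z⟫_ℂ‖ ≤ E) :
    ‖ContinuousLinearMap.adjoint (frameOp μ K β g h) ∘L frameOp μ K α g h‖ ≤
      E * N ^ 2 * (∫ z in K, ‖α z‖ ∂μ) * ∫ z in K, ‖β z‖ ∂μ := by
  have hβ0 : 0 ≤ ∫ z in K, ‖β z‖ ∂μ := integral_nonneg fun _ => norm_nonneg _
  have hα0 : 0 ≤ ∫ z in K, ‖α z‖ ∂μ := integral_nonneg fun _ => norm_nonneg _
  refine ContinuousLinearMap.opNorm_le_bound _ (by positivity) fun φ => ?_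
  set B := ContinuousLinearMap.adjoint (frameOp μ K β g h) with hB
  rw [ContinuousLinearMap.comp_apply, frameOp_apply hK hα hg hh,
    ← B.integral_comp_comm (integrableOn_smul hK (by fun_prop) hg)]
  refine (norm_integral_le_integral_norm _).trans ?_
  have key : ∀ z, ‖B ((α z * ⟪h z, φ⟫_ℂ) • g z)‖ ≤
      ‖α z‖ * ((E * N ^ 2 * ∫ z in K, ‖β z‖ ∂μ) * ‖φ‖) := by
    intro z
    rw [map_smul, norm_smul, norm_mul, mul_assoc]
    -- The overlap bound `E` holds only where both amplitudes are nonzero; this is how separation of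
    -- the supports enters.
    by_cases hz : α z = 0
    · simp [hz]
    have hN0 : 0 ≤ N := (norm_nonneg _).trans_eq (hN z)
    have h1 : ‖⟪h z, φ⟫_ℂ‖ ≤ N * ‖φ‖ := by
      simpa [hN] using norm_inner_le_norm (𝕜 := ℂ) (h z) φ
    have h2 : ‖B (g z)‖ ≤ (∫ w in K, ‖β w‖ ∂μ) * (E * N) := by
      refine (norm_adjoint_frameOp_apply_le hK hβ hg hh hN (g z)).trans ?_
      rw [← integral_mul_const]
      refine setIntegral_mono (integrableOn_of_continuous hK (by fun_prop))
        (integrableOn_of_continuous hK (by fun_prop)) fun w => ?_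
      dsimp only
      by_cases hw : β w = 0
      · simp [hw]
      rw [mul_assoc]
      gcongr
      exact hE z w hz hw
    calc ‖α z‖ * (‖⟪h z, φ⟫_ℂ‖ * ‖B (g z)‖)
        ≤ ‖α z‖ * ((N * ‖φ‖) * ((∫ w in K, ‖β w‖ ∂μ) * (E * N))) := by gcongr
      _ = _ := by ring
  calc ∫ z in K, ‖B ((α z * ⟪h z, φ⟫_ℂ) • g z)‖ ∂μ
      ≤ ∫ z in K, ‖α z‖ * ((E * N ^ 2 * ∫ z in K, ‖β z‖ ∂μ) * ‖φ‖) ∂μ :=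
        setIntegral_mono (integrableOn_of_continuous hK (by fun_prop))
          (integrableOn_of_continuous hK (by fun_prop)) key
    _ = _ := by rw [integral_mul_const]; ring

/-- Boundedness of superpositions of rank-one operators. -/
lemma norm_frameOp_le (hK : IsCompact K) (hα : Continuous α) (hg : Continuous g)
    (hh : Continuous h) {Cg Ch U : ℝ} (hCg0 : 0 ≤ Cg) (hCh0 : 0 ≤ Ch) (hU0 : 0 ≤ U)
    (hCg : ∀ z, ∫ w in K, ‖⟪g w, g z⟫_ℂ‖ ∂μ ≤ Cg) (hCh : ∀ z, ∫ w in K, ‖⟪h w, h z⟫_ℂ‖ ∂μ ≤ Ch)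
    (hU : ∀ z, ‖α z‖ ≤ U) : ‖frameOp μ K α g h‖ ≤ √(Cg * Ch) * U := by
  refine ContinuousLinearMap.opNorm_le_bound _ (by positivity) fun φ => ?_
  refine abs_le_of_sq_le_sq' ?_ (by positivity) |>.2
  rw [frameOp_apply hK hα hg hh, mul_pow, mul_pow, Real.sq_sqrt (by positivity)]
  refine (norm_setIntegral_smul_sq_le hK (by fun_prop) hg hCg).trans ?_
  have h1 : ∫ z in K, ‖α z * ⟪h z, φ⟫_ℂ‖ ^ 2 ∂μ ≤ U ^ 2 * (Ch * ‖φ‖ ^ 2) := by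
    refine le_trans ?_ (mul_le_mul_of_nonneg_left (setIntegral_norm_inner_sq_le hK hh hCh0 hCh φ)
      (sq_nonneg U))
    rw [← integral_const_mul]
    refine setIntegral_mono (integrableOn_of_continuous hK (by fun_prop))
      (integrableOn_of_continuous hK (by fun_prop)) fun z => ?_
    dsimp only
    rw [norm_mul, mul_pow]
    gcongr
    exact hU z
  calc Cg * ∫ z in K, ‖α z * ⟪h z, φ⟫_ℂ‖ ^ 2 ∂μ ≤ Cg * (U ^ 2 * (Ch * ‖φ‖ ^ 2)) := by gcongr
    _ = _ := by ring

end FrameOperators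
end
end CplxPhaseOp

namespace CplxPhaseOp

noncomputable section

/-! ### Changes of variables with constant Jacobian -/

section ChangeOfVariables

open MeasureTheory

/-- Serves both invertible linear maps and canonical transformations. No integrability is required,
since the area formula for Bochner integrals needs none. -/
lemma integral_eq_smul_integral_comp {E F : Type*} [NormedAddCommGroup E] [NormedSpace ℝ E]
    [FiniteDimensional ℝ E] [MeasurableSpace E] [BorelSpace E] {μ : Measure E}
    [μ.IsAddHaarMeasure] [NormedAddCommGroup F] [NormedSpace ℝ F] {f : E → E} {f' : E → E →L[ℝ] E}
    {D : ℝ} (hf : ∀ x, HasFDerivAt f (f' x) x) (hbij : Function.Bijective f)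
    (hD : ∀ x, |(f' x).det| = D) (G : E → F) :
    ∫ x, G x ∂μ = D • ∫ x, G (f x) ∂μ := by
  have := integral_image_eq_integral_abs_det_fderiv_smul μ MeasurableSet.univ
    (fun x _ => (hf x).hasFDerivWithinAt) hbij.1.injOn G
  rw [Set.image_univ, hbij.2.range_eq, setIntegral_univ, setIntegral_univ] at this
  rw [this, ← integral_smul]
  simp [hD]

lemma det_toEuclideanCLM {n : Type*} [Fintype n] [DecidableEq n] (A : Matrix n n ℝ) :
    (Matrix.toEuclideanCLM (𝕜 := ℝ) A : EuclideanSpace ℝ n →L[ℝ] EuclideanSpace ℝ n).det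
      = A.det := by
  rw [ContinuousLinearMap.det, Matrix.coe_toEuclideanCLM_eq_toEuclideanLin,
    Matrix.toEuclideanLin, Matrix.toLpLin_eq_toLin, LinearMap.det_toLin]

lemma toEuclideanCLM_mul_apply {n : Type*} [Fintype n] [DecidableEq n] (A B : Matrix n n ℝ)
    (x : EuclideanSpace ℝ n) :
    Matrix.toEuclideanCLM (𝕜 := ℝ) (A * B) x =
      Matrix.toEuclideanCLM (𝕜 := ℝ) A (Matrix.toEuclideanCLM (𝕜 := ℝ) B x) := by
  rw [map_mul]; rfl

lemma integral_comp_toEuclideanCLM {n F : Type*} [Fintype n] [DecidableEq n]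
    [NormedAddCommGroup F] [NormedSpace ℝ F] {A : Matrix n n ℝ} (hA : IsUnit A.det)
    (G : EuclideanSpace ℝ n → F) :
    ∫ x, G x = |A.det| • ∫ x, G (Matrix.toEuclideanCLM (𝕜 := ℝ) A x) := by
  refine integral_eq_smul_integral_comp
    (fun x => (Matrix.toEuclideanCLM (𝕜 := ℝ) A).hasFDerivAt) ?_
    (fun _ => by rw [det_toEuclideanCLM]) G
  refine Function.bijective_iff_has_inverse.2
    ⟨Matrix.toEuclideanCLM (𝕜 := ℝ) A⁻¹, fun x => ?_, fun x => ?_⟩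
  · rw [← toEuclideanCLM_mul_apply, Matrix.nonsing_inv_mul _ hA, map_one]; rfl
  · rw [← toEuclideanCLM_mul_apply, Matrix.mul_nonsing_inv _ hA, map_one]; rfl

lemma inner_toEuclideanCLM_left {n : Type*} [Fintype n] [DecidableEq n] {A : Matrix n n ℝ}
    (hA : A.IsSymm) (x y : EuclideanSpace ℝ n) :
    inner ℝ (Matrix.toEuclideanCLM (𝕜 := ℝ) A x) y =
      inner ℝ x (Matrix.toEuclideanCLM (𝕜 := ℝ) A y) := by
  rw [real_inner_comm, Matrix.inner_toEuclideanCLM, Matrix.inner_toEuclideanCLM,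
    Matrix.dotProduct_mulVec, ← Matrix.mulVec_transpose, hA.eq, dotProduct_comm]

end ChangeOfVariables

/-! ### Gaussian wave packets and their overlaps -/

section WavePackets

open MeasureTheory Complex

variable {d : ℕ} {ε : ℝ} {Θ : Matrix (Fin d) (Fin d) ℂ}

/-- The position component `q` of `z = (q, p)`. -/
def posPart (z : Phase d) : Pos d := WithLp.toLp 2 fun i => z (Sum.inl i)

/-- The momentum component `p` of `z = (q, p)`. -/
def momPart (z : Phase d) : Pos d := WithLp.toLp 2 fun i => z (Sum.inr i)

variable (Θ) in
/-- `(Re Θ)^{1/2}` as an operator. -/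
def rootRe : Pos d →L[ℝ] Pos d := Matrix.toEuclideanCLM (𝕜 := ℝ) (CFC.sqrt (reMat Θ))

variable (Θ) in
/-- `(Re Θ)^{-1/2}` as an operator. -/
def rootReInv : Pos d →L[ℝ] Pos d := Matrix.toEuclideanCLM (𝕜 := ℝ) (CFC.sqrt (reMat Θ))⁻¹

variable (Θ) in
/-- `Im Θ` as an operator. -/
def imOp : Pos d →L[ℝ] Pos d := Matrix.toEuclideanCLM (𝕜 := ℝ) (imMat Θ)

lemma IsWidth.det_sqrt (hΘ : IsWidth Θ) : (CFC.sqrt (reMat Θ)).det = √(reMat Θ).det := by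
  simpa using hΘ.posDef.posSemidef.det_sqrt

lemma IsWidth.det_pos (hΘ : IsWidth Θ) : 0 < (reMat Θ).det := hΘ.posDef.det_pos

lemma IsWidth.isUnit_det_sqrt (hΘ : IsWidth Θ) : IsUnit (CFC.sqrt (reMat Θ)).det := by
  rw [hΘ.det_sqrt, isUnit_iff_ne_zero]
  exact (Real.sqrt_pos.2 hΘ.det_pos).ne'

lemma isSymm_sqrt (A : Matrix (Fin d) (Fin d) ℝ) : (CFC.sqrt A).IsSymm := by
  have : (CFC.sqrt A).PosSemidef := Matrix.nonneg_iff_posSemidef.1 (CFC.sqrt_nonneg A)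
  rw [Matrix.IsSymm, ← Matrix.conjTranspose_eq_transpose_of_trivial]
  exact this.1

lemma IsWidth.isSymm_imMat (hΘ : IsWidth Θ) : (imMat Θ).IsSymm := by
  ext i j
  simp [imMat, hΘ.symm.apply i j]

lemma reMat_conjMat (Θ : Matrix (Fin d) (Fin d) ℂ) : reMat (conjMat Θ) = reMat Θ := by
  ext i j; simp [reMat, conjMat]

lemma IsWidth.conjMat (hΘ : IsWidth Θ) : IsWidth (conjMat Θ) where
  symm := by
    ext i j
    simp [CplxPhaseOp.conjMat, hΘ.symm.apply i j]
  posDef := by rw [reMat_conjMat]; exact hΘ.posDef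

lemma quad_eq (hΘ : IsWidth Θ) (w : Pos d) :
    quad Θ (fun i => w i) = ((‖rootRe Θ w‖ ^ 2 : ℝ) : ℂ) + I * (inner ℝ w (imOp Θ w) : ℝ) := by
  have h1 : ‖rootRe Θ w‖ ^ 2 = ∑ i, ∑ j, w i * (reMat Θ i j * w j) := by
    rw [← real_inner_self_eq_norm_sq, rootRe, inner_toEuclideanCLM_left (isSymm_sqrt _),
      ← toEuclideanCLM_mul_apply, CFC.sqrt_mul_sqrt_self _ hΘ.posDef.posSemidef.nonneg,
      Matrix.inner_toEuclideanCLM]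
    simp [dotProduct, Matrix.mulVec, Finset.mul_sum]
  have h2 : inner ℝ w (imOp Θ w) = ∑ i, ∑ j, w i * (imMat Θ i j * w j) := by
    rw [imOp, Matrix.inner_toEuclideanCLM]
    simp [dotProduct, Matrix.mulVec, Finset.mul_sum]
  rw [h1, h2, quad]
  push_cast
  simp only [Finset.mul_sum, ← Finset.sum_add_distrib]
  refine Finset.sum_congr rfl fun i _ => Finset.sum_congr rfl fun j _ => ?_
  nth_rewrite 1 [← Complex.re_add_im (Θ i j)]
  simp only [reMat, imMat, Matrix.map_apply]
  ring

/-- These two squares are what the overlap integral produces: the first from the distance of the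
centres, the second from the Fourier transform of the Gaussian. -/
lemma norm_LamMap_sq (z : Phase d) :
    ‖LamMap Θ z‖ ^ 2 = ‖rootRe Θ (posPart z)‖ ^ 2 +
      ‖rootReInv Θ (imOp Θ (posPart z) + momPart z)‖ ^ 2 := by
  rw [EuclideanSpace.norm_sq_eq, EuclideanSpace.norm_sq_eq, EuclideanSpace.norm_sq_eq,
    Fintype.sum_sum_type]
  have h : WithLp.ofLp z = Sum.elim (WithLp.ofLp (posPart z)) (WithLp.ofLp (momPart z)) := by
    ext i; rcases i with i | i <;> rfl
  congr 1
  · refine Finset.sum_congr rfl fun i _ => ?_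
    rw [LamMap, Matrix.ofLp_toEuclideanCLM, Lam, h, Matrix.fromBlocks_mulVec]
    simp [rootRe, Matrix.ofLp_toEuclideanCLM]
  · refine Finset.sum_congr rfl fun i _ => ?_
    rw [LamMap, Matrix.ofLp_toEuclideanCLM, Lam, h, Matrix.fromBlocks_mulVec]
    simp [rootReInv, imOp, Matrix.ofLp_toEuclideanCLM, Matrix.mulVec_mulVec]

lemma det_Lam (hΘ : IsWidth Θ) : (Lam Θ).det = 1 := by
  rw [Lam, Matrix.det_fromBlocks_zero₁₂, ← Matrix.det_mul,
    Matrix.mul_nonsing_inv _ hΘ.isUnit_det_sqrt, Matrix.det_one]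

variable (ε Θ) in
/-- The Gaussian wave packet centred at `z = (q, p)` with width matrix `Θ`. -/
def packet (z : Phase d) (x : Pos d) : ℂ :=
  cexp (I / ε * ((∑ i : Fin d, z (Sum.inr i) * (x i - z (Sum.inl i)) : ℝ) : ℂ) +
    I / ε * (I / 2 * quad Θ fun i => x i - z (Sum.inl i)))

lemma continuous_packet : Continuous (Function.uncurry (packet ε Θ)) := by
  simp only [Function.uncurry_def, packet, quad]
  fun_prop

lemma packet_eq (hΘ : IsWidth Θ) (z : Phase d) (x : Pos d) :
    packet ε Θ z x = cexp (((-(‖rootRe Θ (x - posPart z)‖ ^ 2) / (2 * ε) : ℝ) : ℂ) +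
      ((inner ℝ (momPart z) (x - posPart z) / ε -
        inner ℝ (x - posPart z) (imOp Θ (x - posPart z)) / (2 * ε) : ℝ) : ℂ) * I) := by
  have h := quad_eq hΘ (x - posPart z)
  have h' : inner ℝ (momPart z) (x - posPart z) =
      ∑ i : Fin d, z (Sum.inr i) * (x i - z (Sum.inl i)) := by
    rw [PiLp.inner_apply]
    exact Finset.sum_congr rfl fun i _ => by simp [momPart, posPart, mul_comm]
  rw [packet, h']
  have h'' : quad Θ (fun i => x i - z (Sum.inl i)) = quad Θ fun i => (x - posPart z) i := rfl
  rw [h'', h]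
  congr 1
  push_cast
  ring_nf
  simp only [I_sq, I_pow_three]
  ring

lemma norm_packet_le (hε : 0 < ε) (hΘ : IsWidth Θ) (z : Phase d) (x : Pos d) :
    ‖packet ε Θ z x‖ ≤ 1 := by
  rw [packet_eq hΘ, Complex.norm_exp]
  simp only [add_re, ofReal_re, re_ofReal_mul, I_re, mul_zero, add_zero]
  rw [Real.exp_le_one_iff, neg_div]
  have : 0 ≤ ‖rootRe Θ (x - posPart z)‖ ^ 2 / (2 * ε) := by positivity
  linarith

variable (ε Θ) in
/-- The squared `L²` norm of a wave packet. -/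
def packetMass : ℝ := (Real.pi * ε) ^ ((d : ℝ) / 2) / √(reMat Θ).det

lemma packetMass_pos (hε : 0 < ε) (hΘ : IsWidth Θ) : 0 < packetMass ε Θ := by
  have := hΘ.det_pos
  unfold packetMass
  positivity

/-- The substitution by (Re Θ)^{1/2} makes the Gaussian isotropic, at the cost of the determinant in
`packetMass`; the frequency transforms by the inverse root. -/
lemma integral_gaussian (hε : 0 < ε) (hΘ : IsWidth Θ) (v : Pos d) :
    ∫ s : Pos d, cexp (((-(‖rootRe Θ s‖ ^ 2) / ε : ℝ) : ℂ) + ((inner ℝ v s / ε : ℝ) : ℂ) * I) =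
      packetMass ε Θ * cexp ((-(‖rootReInv Θ v‖ ^ 2) / (4 * ε) : ℝ) : ℂ) := by
  have h1 := GaussianFourier.integral_cexp_neg_mul_sq_norm_add (V := Pos d) (b := ((1 / ε : ℝ) : ℂ))
    (by rw [ofReal_re]; positivity) (I / ε) (rootReInv Θ v)
  rw [integral_comp_toEuclideanCLM hΘ.isUnit_det_sqrt, hΘ.det_sqrt,
    abs_of_nonneg (Real.sqrt_nonneg _)] at h1
  have hd : 0 < √(reMat Θ).det := Real.sqrt_pos.2 hΘ.det_pos
  have h2 : ∀ s : Pos d, inner ℝ (rootReInv Θ v) (rootRe Θ s) = inner ℝ v s := by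
    intro s
    have hs : ((CFC.sqrt (reMat Θ))⁻¹).IsSymm := by
      rw [Matrix.IsSymm, Matrix.transpose_nonsing_inv, (isSymm_sqrt _).eq]
    rw [rootReInv, rootRe, inner_toEuclideanCLM_left hs, ← toEuclideanCLM_mul_apply,
      Matrix.nonsing_inv_mul _ hΘ.isUnit_det_sqrt, map_one]
    rfl
  have h3 : ∫ s : Pos d, cexp (((-(‖rootRe Θ s‖ ^ 2) / ε : ℝ) : ℂ) +
      ((inner ℝ v s / ε : ℝ) : ℂ) * I) =
      ∫ x : Pos d, cexp (-((1 / ε : ℝ) : ℂ) *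
        ‖Matrix.toEuclideanCLM (𝕜 := ℝ) (CFC.sqrt (reMat Θ)) x‖ ^ 2 + I / ε *
          (inner ℝ (rootReInv Θ v)
            (Matrix.toEuclideanCLM (𝕜 := ℝ) (CFC.sqrt (reMat Θ)) x) : ℝ)) := by
    congr 1 with s
    have := h2 s
    rw [rootRe] at this
    rw [this, rootRe]
    congr 1
    push_cast
    ring
  have hεC : (ε : ℂ) ≠ 0 := by exact_mod_cast hε.ne'
  have h4 : ((Real.pi : ℂ) / ((1 / ε : ℝ) : ℂ)) ^ ((Module.finrank ℝ (Pos d) : ℂ) / 2) =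
      (((Real.pi * ε) ^ ((d : ℝ) / 2) : ℝ) : ℂ) := by
    rw [Complex.ofReal_cpow (by positivity)]
    simp
  have h5 : (I / (ε : ℂ)) ^ 2 * (‖rootReInv Θ v‖ : ℂ) ^ 2 / (4 * ((1 / ε : ℝ) : ℂ)) =
      ((-(‖rootReInv Θ v‖ ^ 2) / (4 * ε) : ℝ) : ℂ) := by
    push_cast
    field_simp
    simp
  rw [h4, h5, ← h3] at h1
  rw [packetMass, ofReal_div, div_mul_eq_mul_div, eq_div_iff (by exact_mod_cast hd.ne'), ← h1,
    real_smul, mul_comm]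

/-- The overlap of two wave packets of the same width. -/
lemma integral_conj_packet_mul_packet (hε : 0 < ε) (hΘ : IsWidth Θ) (w z : Phase d) :
    ∫ x, (starRingEnd ℂ) (packet ε Θ w x) * packet ε Θ z x =
      packetMass ε Θ * (Real.exp (-(‖LamMap Θ (z - w)‖ ^ 2) / (4 * ε)) *
        cexp ((-(inner ℝ (momPart z + momPart w) (posPart z - posPart w)) / (2 * ε) : ℝ) * I)) := by
  -- Centring at the midpoint removes the cross term from the Re Θ part, by the parallelogram law,
  -- and leaves the Im Θ part linear in `s`. The remaining integral is the Fourier transform of a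
  -- Gaussian at frequency `v`.
  set m : Pos d := (1 / 2 : ℝ) • (posPart z + posPart w) with hm
  set δ : Pos d := (1 / 2 : ℝ) • (posPart z - posPart w) with hδ
  set v : Pos d := imOp Θ (posPart z - posPart w) + (momPart z - momPart w) with hv
  have hz : ∀ s : Pos d, s + m - posPart z = s - δ := fun s => by rw [hm, hδ]; module
  have hw : ∀ s : Pos d, s + m - posPart w = s + δ := fun s => by rw [hm, hδ]; module
  have h2δ : posPart z - posPart w = (2 : ℝ) • δ := by rw [hδ]; module
  rw [← integral_add_right_eq_self _ m]
  have hB : ∀ s t : Pos d, inner ℝ (imOp Θ s) t = inner ℝ s (imOp Θ t) :=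
    fun s t => inner_toEuclideanCLM_left hΘ.isSymm_imMat s t
  have key : ∀ s : Pos d, (starRingEnd ℂ) (packet ε Θ w (s + m)) * packet ε Θ z (s + m) =
      cexp (((-(‖rootRe Θ δ‖ ^ 2) / ε : ℝ) : ℂ) +
        ((-(inner ℝ (momPart z + momPart w) (posPart z - posPart w)) / (2 * ε) : ℝ) : ℂ) * I) *
      cexp (((-(‖rootRe Θ s‖ ^ 2) / ε : ℝ) : ℂ) + ((inner ℝ v s / ε : ℝ) : ℂ) * I) := by
    intro s
    rw [packet_eq hΘ, packet_eq hΘ, hz, hw, ← Complex.exp_conj, ← Complex.exp_add,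
      ← Complex.exp_add]
    have e1 : ‖rootRe Θ (s + δ)‖ ^ 2 + ‖rootRe Θ (s - δ)‖ ^ 2 =
        2 * (‖rootRe Θ s‖ ^ 2 + ‖rootRe Θ δ‖ ^ 2) := by
      rw [map_add, map_sub]
      have := parallelogram_law_with_norm ℝ (rootRe Θ s) (rootRe Θ δ)
      nlinarith
    have e2 : inner ℝ (s + δ) (imOp Θ (s + δ)) - inner ℝ (s - δ) (imOp Θ (s - δ)) =
        4 * inner ℝ s (imOp Θ δ) := by
      simp only [map_add, map_sub, inner_add_left, inner_add_right, inner_sub_left,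
        inner_sub_right]
      have : inner ℝ δ (imOp Θ s) = inner ℝ s (imOp Θ δ) := by
        rw [← hB, real_inner_comm]
      rw [this]; ring
    have e3 : inner ℝ v s = 2 * inner ℝ s (imOp Θ δ) + inner ℝ (momPart z) s
        - inner ℝ (momPart w) s := by
      rw [hv, h2δ, map_smul, inner_add_left, inner_sub_left, real_inner_smul_left,
        real_inner_comm s]
      ring
    have e4 : inner ℝ (momPart z + momPart w) (posPart z - posPart w) =
        2 * (inner ℝ (momPart z) δ + inner ℝ (momPart w) δ) := by
      rw [h2δ, real_inner_smul_right, inner_add_left]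
    congr 1
    apply Complex.ext
    · simp only [map_add (starRingEnd ℂ), map_mul, conj_ofReal, conj_I, add_re, ofReal_re, mul_re,
        I_re, mul_zero, ofReal_im, I_im, mul_one, sub_self, add_zero, neg_re, neg_zero, mul_neg]
      field_simp
      linarith
    · simp only [map_add (starRingEnd ℂ), map_mul, conj_ofReal, conj_I, add_im, ofReal_re, mul_im,
        I_re, mul_zero, ofReal_im, I_im, mul_one, zero_add, add_zero, neg_im, mul_neg]
      rw [e3, e4, inner_add_right, inner_sub_right]
      field_simp
      linarith
  simp_rw [key]
  rw [integral_const_mul, integral_gaussian hε hΘ, norm_LamMap_sq]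
  have hpos : posPart (z - w) = posPart z - posPart w := rfl
  have hmom : momPart (z - w) = momPart z - momPart w := rfl
  rw [hpos, hmom, ← hv]
  have e5 : ‖rootRe Θ (posPart z - posPart w)‖ ^ 2 = 4 * ‖rootRe Θ δ‖ ^ 2 := by
    rw [h2δ, map_smul, norm_smul, mul_pow]; norm_num
  rw [e5, ofReal_exp, mul_left_comm, ← Complex.exp_add, ← Complex.exp_add]
  congr 2
  push_cast
  field_simp
  ring

lemma memLp_packet (hε : 0 < ε) (hΘ : IsWidth Θ) (z : Phase d) : MemLp (packet ε Θ z) 2 := by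
  have hc : Continuous (packet ε Θ z) :=
    continuous_packet.comp (by fun_prop : Continuous fun x : Pos d => (z, x))
  rw [memLp_two_iff_integrable_sq_norm hc.aestronglyMeasurable]
  have h : Integrable fun x => (starRingEnd ℂ) (packet ε Θ z x) * packet ε Θ z x := by
    -- The integral of a non-integrable function is 0 by convention, so the explicit nonzero value
    -- already proves integrability.
    refine Integrable.of_integral_ne_zero ?_
    rw [integral_conj_packet_mul_packet hε hΘ]
    refine mul_ne_zero (by exact_mod_cast (packetMass_pos hε hΘ).ne') (mul_ne_zero ?_ ?_)
    · exact_mod_cast (Real.exp_pos _).ne'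
    · exact Complex.exp_ne_zero _
  refine h.norm.congr (Filter.Eventually.of_forall fun x => ?_)
  simp [sq]

/-- Wave packets as elements of `L²`. -/
def packetLp (hε : 0 < ε) (hΘ : IsWidth Θ) (z : Phase d) : L2 d := (memLp_packet hε hΘ z).toLp

lemma inner_packetLp (hε : 0 < ε) (hΘ : IsWidth Θ) (w z : Phase d) :
    inner ℂ (packetLp hε hΘ w) (packetLp hε hΘ z) =
      packetMass ε Θ * (Real.exp (-(‖LamMap Θ (z - w)‖ ^ 2) / (4 * ε)) *
        cexp ((-(inner ℝ (momPart z + momPart w) (posPart z - posPart w)) / (2 * ε) : ℝ) * I)) := by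
  rw [← integral_conj_packet_mul_packet hε hΘ, L2.inner_def]
  refine integral_congr_ae ?_
  filter_upwards [(memLp_packet hε hΘ w).coeFn_toLp, (memLp_packet hε hΘ z).coeFn_toLp]
    with x h1 h2
  rw [packetLp, packetLp, h1, h2, RCLike.inner_apply, mul_comm]

lemma norm_inner_packetLp (hε : 0 < ε) (hΘ : IsWidth Θ) (w z : Phase d) :
    ‖inner ℂ (packetLp hε hΘ w) (packetLp hε hΘ z)‖ =
      packetMass ε Θ * Real.exp (-(‖LamMap Θ (z - w)‖ ^ 2) / (4 * ε)) := by
  rw [inner_packetLp, norm_mul, norm_mul, Complex.norm_exp_ofReal_mul_I, Complex.norm_real,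
    Complex.norm_real, Real.norm_of_nonneg (packetMass_pos hε hΘ).le,
    Real.norm_of_nonneg (Real.exp_pos _).le, mul_one]

lemma norm_packetLp (hε : 0 < ε) (hΘ : IsWidth Θ) (z : Phase d) :
    ‖packetLp hε hΘ z‖ = √(packetMass ε Θ) := by
  have h := norm_inner_packetLp hε hΘ z z
  rw [inner_self_eq_norm_sq_to_K] at h
  simp only [coe_algebraMap, norm_pow, norm_real, norm_norm, sub_self, map_zero, norm_zero, ne_eq,
    OfNat.ofNat_ne_zero, not_false_eq_true, zero_pow, neg_zero, zero_div, Real.exp_zero,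
    mul_one] at h
  rw [← h, Real.sqrt_sq (norm_nonneg _)]

/-- All packets have the same norm, so ‖g_w - g_z‖² is determined by the overlap, whose closed form
is visibly continuous. -/
lemma continuous_packetLp (hε : 0 < ε) (hΘ : IsWidth Θ) :
    Continuous (packetLp hε hΘ : Phase d → L2 d) := by
  rw [continuous_iff_continuousAt]
  intro z
  rw [ContinuousAt, tendsto_iff_norm_sub_tendsto_zero]
  have hsq : ∀ w, ‖packetLp hε hΘ w - packetLp hε hΘ z‖ =
      √(2 * packetMass ε Θ - 2 * (inner ℂ (packetLp hε hΘ w) (packetLp hε hΘ z)).re) := by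
    intro w
    have h := norm_sub_sq (𝕜 := ℂ) (packetLp hε hΘ w) (packetLp hε hΘ z)
    rw [norm_packetLp, norm_packetLp, Real.sq_sqrt (packetMass_pos hε hΘ).le] at h
    rw [← Real.sqrt_sq (norm_nonneg (packetLp hε hΘ w - packetLp hε hΘ z)), h]
    congr 1
    simp only [RCLike.re_eq_complex_re]
    ring
  have hpos : Continuous (posPart : Phase d → Pos d) := by unfold posPart; fun_prop
  have hmom : Continuous (momPart : Phase d → Pos d) := by unfold momPart; fun_prop
  have hcont : Continuous fun w =>
      √(2 * packetMass ε Θ - 2 * (inner ℂ (packetLp hε hΘ w) (packetLp hε hΘ z)).re) := by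
    simp_rw [inner_packetLp]
    fun_prop
  simp_rw [hsq]
  convert! hcont.tendsto z
  rw [← hsq, sub_self, norm_zero]

/-- The total overlap of a wave packet with all wave packets. -/
lemma integral_overlap (hε : 0 < ε) (hΘ : IsWidth Θ) (z : Phase d) :
    ∫ w : Phase d, packetMass ε Θ * Real.exp (-(‖LamMap Θ (z - w)‖ ^ 2) / (4 * ε)) =
      packetMass ε Θ * (4 * Real.pi * ε) ^ d := by
  rw [integral_const_mul, integral_sub_left_eq_self
    (fun w => Real.exp (-(‖LamMap Θ w‖ ^ 2) / (4 * ε)))]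
  congr 1
  -- Λ(Θ) preserves volume, so the overlap integral is a standard Gaussian integral in dimension 2d.
  have hu : IsUnit (Lam Θ).det := by rw [det_Lam hΘ]; exact isUnit_one
  have h := integral_comp_toEuclideanCLM hu
    (fun w : Phase d => Real.exp (-(‖w‖ ^ 2) / (4 * ε)))
  rw [det_Lam hΘ, abs_one, one_smul] at h
  rw [LamMap, ← h]
  have h2 := GaussianFourier.integral_rexp_neg_mul_sq_norm (V := Phase d) (b := 1 / (4 * ε))
    (by positivity)
  have h3 : (Real.pi / (1 / (4 * ε))) ^ ((Module.finrank ℝ (Phase d) : ℝ) / 2) =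
      (4 * Real.pi * ε) ^ d := by
    rw [← Real.rpow_natCast]
    congr 1
    · field_simp
    · simp
  rw [← h3, ← h2]
  congr 1 with w
  congr 1
  field_simp

end WavePackets
end
end CplxPhaseOp

namespace CplxPhaseOp

noncomputable section

/-! ### Volume preservation by canonical transformations -/

section Canonical

open MeasureTheory

variable {d : ℕ} {κ : Phase d → Phase d}

lemma fderiv_eq_toEuclideanCLM_jacobian (κ : Phase d → Phase d) (z : Phase d) :
    fderiv ℝ κ z = Matrix.toEuclideanCLM (𝕜 := ℝ) (jacobian κ z) := by
  apply ContinuousLinearMap.coe_injective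
  refine (EuclideanSpace.basisFun (Fin d ⊕ Fin d) ℝ).toBasis.ext fun j => ?_
  ext i
  simp [Matrix.ofLp_toEuclideanCLM, jacobian, pderiv]

/-- Determinants in FᵀJF = J, with J invertible, give (det F)² = 1. -/
lemma IsCanonical.abs_det_fderiv (hκ : IsCanonical κ) (z : Phase d) :
    |(fderiv ℝ κ z).det| = 1 := by
  rw [fderiv_eq_toEuclideanCLM_jacobian, det_toEuclideanCLM]
  have hJ : (symplJ d).det ≠ 0 := by
    refine (Matrix.isUnit_det_of_right_inverse (B := -symplJ d) ?_).ne_zero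
    simp [symplJ, Matrix.fromBlocks_neg, Matrix.fromBlocks_multiply]
  have h := congrArg Matrix.det (hκ.symplectic z)
  rw [Matrix.det_mul, Matrix.det_mul, Matrix.det_transpose] at h
  have h2 : (jacobian κ z).det ^ 2 = 1 := by
    apply mul_right_cancel₀ hJ
    linarith
  rwa [← one_pow 2, sq_eq_sq_iff_abs_eq_abs, abs_one] at h2

/-- Liouville's theorem for canonical transformations. -/
lemma IsCanonical.integral_comp (hκ : IsCanonical κ) (G : Phase d → ℝ) :
    ∫ z, G (κ z) = ∫ z, G z := by
  obtain ⟨κinv, -, hl, hr⟩ := hκ.smooth_inv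
  rw [integral_eq_smul_integral_comp (f' := fderiv ℝ κ)
    (fun z => (hκ.smooth.differentiable (by simp) z).hasFDerivAt)
    ⟨hl.injective, hr.surjective⟩ hκ.abs_det_fderiv G, one_smul]

end Canonical

/-! ### Bounded extension of the operators to L² -/

section Extension

open MeasureTheory Complex

variable {d : ℕ} {ε : ℝ} {Θ Θx Θy : Matrix (Fin d) (Fin d) ℂ} {κ : Phase d → Phase d}
  {S : Phase d → ℝ} {u : Phase d → ℂ} {K : Set (Phase d)}

/-- This is Schur's condition: enlarge `K` to all of phase space, remove κ by invariance of the
integral, and evaluate the Gaussian. Requiring only that invariance covers the identity too, as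
needed for the `y`-packets. -/
lemma setIntegral_norm_inner_packetLp_le (hε : 0 < ε) (hΘ : IsWidth Θ)
    (hκ : ∀ G : Phase d → ℝ, ∫ z, G (κ z) = ∫ z, G z) (z : Phase d) :
    ∫ w in K, ‖inner ℂ (packetLp hε hΘ (κ w)) (packetLp hε hΘ (κ z))‖ ≤
      packetMass ε Θ * (4 * Real.pi * ε) ^ d := by
  simp_rw [norm_inner_packetLp]
  have h := hκ fun w => packetMass ε Θ * Real.exp (-(‖LamMap Θ (κ z - w)‖ ^ 2) / (4 * ε))
  rw [integral_overlap hε hΘ] at h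
  have hm := packetMass_pos hε hΘ
  rw [← h]
  refine setIntegral_le_integral (Integrable.of_integral_ne_zero ?_)
    (Filter.Eventually.of_forall fun w => by dsimp only [Pi.zero_apply]; positivity)
  rw [h]
  positivity

/-- Pointwise evaluation of a superposition of wave packets. -/
lemma coeFn_setIntegral_smul_packetLp (hε : 0 < ε) (hΘ : IsWidth Θ) (hK : IsCompact K)
    (hκ : Continuous κ) {a : Phase d → ℂ} (ha : Continuous a) :
    ((∫ z in K, a z • packetLp hε hΘ (κ z) : L2 d) : Pos d → ℂ) =ᵐ[volume]
      fun x => ∫ z in K, a z * packet ε Θ (κ z) x := by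
  have hc : Continuous fun p : Pos d × Phase d => a p.2 * packet ε Θ (κ p.2) p.1 :=
    (ha.comp continuous_snd).mul
      (continuous_packet.comp ((hκ.comp continuous_snd).prodMk continuous_fst))
  have hprod : ∀ s : Set (Pos d), volume s < ⊤ →
      Integrable (Function.uncurry fun (x : Pos d) z => a z * packet ε Θ (κ z) x)
        ((volume.restrict s).prod (volume.restrict K)) := by
    intro s hs
    have : IsFiniteMeasure (volume.restrict s) := ⟨by simpa using hs⟩
    have hb : Integrable (fun p : Pos d × Phase d => (1 : ℝ) * ‖a p.2‖)
        ((volume.restrict s).prod (volume.restrict K)) :=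
      (integrable_const (1 : ℝ)).mul_prod (integrableOn_of_continuous hK ha).norm
    refine hb.mono' hc.aestronglyMeasurable (Filter.Eventually.of_forall fun p => ?_)
    simp only [Function.uncurry, norm_mul, one_mul]
    exact mul_le_of_le_one_right (norm_nonneg _) (norm_packet_le hε hΘ _ _)
  have hg : Continuous fun z => packetLp hε hΘ (κ z) := (continuous_packetLp hε hΘ).comp hκ
  -- Both sides are compared through their integrals over sets of finite measure. On such a set the
  -- packets, bounded by 1, allow Fubini; the integral of an L² function is its pairing with an
  -- indicator.
  refine ae_eq_of_forall_setIntegral_eq_of_sigmaFinite (fun s hs hs' => ?_) (fun s hs hs' => ?_)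
    fun s hs hs' => ?_
  · exact integrableOn_Lp_of_measure_ne_top _ (by norm_num) hs'.ne
  · exact (hprod s hs').integral_prod_left
  · rw [integral_integral_swap (hprod s hs'), ← L2.inner_indicatorConstLp_one hs hs'.ne,
      ← integral_inner (integrableOn_smul hK ha hg)]
    congr 1 with z
    rw [inner_smul_right, L2.inner_indicatorConstLp_one, integral_const_mul]
    congr 1
    exact integral_congr_ae (ae_restrict_of_ae (memLp_packet hε hΘ (κ z)).coeFn_toLp)

lemma conj_quad_conjMat (Θ : Matrix (Fin d) (Fin d) ℂ) (w : Fin d → ℝ) :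
    (starRingEnd ℂ) (quad (conjMat Θ) w) = quad Θ w := by
  simp [quad, conjMat]

/-- The `y`-packet appears conjugated because it is the dual vector of the rank-one operator.
Conjugation supplies the sign of -p·(y - q) and must be undone on the width, hence conj Θ^y. -/
lemma exp_phase (κ : Phase d → Phase d) (S : Phase d → ℝ) (Θx Θy : Matrix (Fin d) (Fin d) ℂ)
    (x y : Pos d) (z : Phase d) :
    cexp (I / ε * phase κ S Θx Θy x y z) = cexp (I / ε * S z) * packet ε Θx (κ z) x *
      (starRingEnd ℂ) (packet ε (conjMat Θy) z y) := by
  simp only [packet, ← Complex.exp_conj, ← Complex.exp_add, phase]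
  congr 1
  simp only [map_add, map_mul, map_div₀, conj_I, conj_ofReal, conj_quad_conjMat, map_ofNat]
  push_cast
  ring

variable (ε S u) in
/-- The amplitude of the wave packet superposition representing the operator. -/
def amplitude (z : Phase d) : ℂ :=
  (((2 * Real.pi * ε) ^ (-(3 * (d : ℝ) / 2)) : ℝ) : ℂ) * cexp (I / ε * S z) * u z

lemma continuous_amplitude (hS : Continuous S) (hu : Continuous u) :
    Continuous (amplitude ε S u) := by
  unfold amplitude
  fun_prop

lemma norm_amplitude (hε : 0 < ε) (z : Phase d) :
    ‖amplitude ε S u z‖ = (2 * Real.pi * ε) ^ (-(3 * (d : ℝ) / 2)) * ‖u z‖ := by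
  have h : I / (ε : ℂ) * S z = ((S z / ε : ℝ) : ℂ) * I := by push_cast; ring
  rw [amplitude, norm_mul, norm_mul, h, Complex.norm_exp_ofReal_mul_I, mul_one, Complex.norm_real,
    Real.norm_of_nonneg (by positivity)]

variable (κ S u K) in
/-- The bounded operator on `L²` representing the Fourier integral operator. -/
def packetOp (hε : 0 < ε) (hx : IsWidth Θx) (hy : IsWidth Θy) : L2 d →L[ℂ] L2 d :=
  frameOp volume K (amplitude ε S u) (fun z => packetLp hε hx (κ z)) (packetLp hε hy.conjMat)

lemma integrable_superposition (hε : 0 < ε) (hΘ : IsWidth Θ) (hK : IsCompact K)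
    {G : Phase d → ℂ} (hG : Continuous G) (φ : SchwartzMap (Pos d) ℂ) :
    Integrable (Function.uncurry fun (y : Pos d) z =>
      G z * ((starRingEnd ℂ) (packet ε Θ z y) * φ y)) (volume.prod (volume.restrict K)) := by
  have hb : Integrable (fun p : Pos d × Phase d => ‖φ p.1‖ * ‖G p.2‖)
      (volume.prod (volume.restrict K)) :=
    φ.integrable.norm.mul_prod (integrableOn_of_continuous hK hG).norm
  have hp : Continuous fun p : Pos d × Phase d => packet ε Θ p.2 p.1 :=
    continuous_packet.comp (continuous_snd.prodMk continuous_fst)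
  have hφ := φ.continuous
  refine hb.mono' (Continuous.aestronglyMeasurable ?_) (Filter.Eventually.of_forall fun p => ?_)
  · simp only [Function.uncurry_def]
    fun_prop
  · simp only [Function.uncurry]
    rw [norm_mul, mul_comm, norm_mul _ (φ p.1), RCLike.norm_conj]
    gcongr
    exact mul_le_of_le_one_left (norm_nonneg _) (norm_packet_le hε hΘ _ _)

/-- After Fubini, justified by the decay of the Schwartz function in `y` and compactness of `K` in
z, the `y`-integral is an L² inner product with a packet. -/
lemma fio_eq (hε : 0 < ε) (hy : IsWidth Θy) (hK : IsCompact K)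
    (hκ : Continuous κ) (hS : Continuous S) (hu : Continuous u) (huK : ∀ z ∉ K, u z = 0)
    (φ : SchwartzMap (Pos d) ℂ) (x : Pos d) :
    fio ε κ S Θx Θy u φ x = ∫ z in K, (amplitude ε S u z *
      inner ℂ (packetLp hε hy.conjMat z) (φ.toLp 2)) * packet ε Θx (κ z) x := by
  have hpx : Continuous fun z => packet ε Θx (κ z) x :=
    continuous_packet.comp (hκ.prodMk continuous_const)
  have hA := continuous_amplitude (ε := ε) hS hu
  have h1 : ∀ y, kernel ε κ S Θx Θy u x y * φ y = ∫ z in K,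
      (amplitude ε S u z * packet ε Θx (κ z) x) *
        ((starRingEnd ℂ) (packet ε (conjMat Θy) z y) * φ y) := by
    intro y
    rw [setIntegral_eq_integral_of_forall_compl_eq_zero
      (fun z hz => by simp [amplitude, huK z hz]), kernel, ← integral_const_mul,
      ← integral_mul_const]
    congr 1 with z
    rw [exp_phase, amplitude]
    ring
  have hprod : Integrable (Function.uncurry fun (y : Pos d) z =>
      (amplitude ε S u z * packet ε Θx (κ z) x) *
        ((starRingEnd ℂ) (packet ε (conjMat Θy) z y) * φ y))
      (volume.prod (volume.restrict K)) :=
    integrable_superposition (G := fun z => amplitude ε S u z * packet ε Θx (κ z) x)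
      hε hy.conjMat hK (hA.mul hpx) φ
  rw [fio]
  simp_rw [h1]
  rw [integral_integral_swap hprod]
  congr 1 with z
  rw [integral_const_mul, mul_right_comm]
  congr 2
  rw [L2.inner_def]
  refine integral_congr_ae ?_
  filter_upwards [(memLp_packet hε hy.conjMat z).coeFn_toLp, φ.coeFn_toLp 2] with y e1 e2
  rw [packetLp, e1, e2, RCLike.inner_apply, mul_comm]

lemma extendsToL2_packetOp (hε : 0 < ε) (hx : IsWidth Θx) (hy : IsWidth Θy) (hK : IsCompact K)
    (hκ : Continuous κ) (hS : Continuous S) (hu : Continuous u) (huK : ∀ z ∉ K, u z = 0) :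
    ExtendsToL2 (fio ε κ S Θx Θy u) (packetOp κ S u K hε hx hy) := by
  intro φ
  have hh := continuous_packetLp hε hy.conjMat
  have hg : Continuous fun z => packetLp hε hx (κ z) := (continuous_packetLp hε hx).comp hκ
  rw [packetOp, frameOp_apply hK (continuous_amplitude hS hu) hg hh]
  refine (coeFn_setIntegral_smul_packetLp hε hx hK hκ
    ((continuous_amplitude hS hu).mul (by fun_prop))).trans ?_
  exact Filter.Eventually.of_forall fun x => (fio_eq hε hy hK hκ hS hu huK φ x).symm

/-- Schwartz functions are dense in L². -/
lemma ExtendsToL2.unique {T : SchwartzMap (Pos d) ℂ → Pos d → ℂ} {A B : L2 d →L[ℂ] L2 d}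
    (hA : ExtendsToL2 T A) (hB : ExtendsToL2 T B) : A = B := by
  have hd := SchwartzMap.denseRange_toLpCLM (E := Pos d) (F := ℂ) (p := 2) (μ := volume)
    (by norm_num)
  have h : (A : L2 d → L2 d) = B := by
    refine hd.equalizer A.continuous B.continuous (funext fun φ => ?_)
    exact Lp.ext ((hA φ).trans (hB φ).symm)
  exact ContinuousLinearMap.ext fun x => congrFun h x

/-- Two prefactors contribute ε^{-3d} and the two masses ε^d; this is the source of ε^{-2d} and of
the constant in (i). -/
lemma sq_prefactor_mul_packetMass (hε : 0 < ε) (hx : IsWidth Θx) (hy : IsWidth Θy) :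
    ((2 * Real.pi * ε) ^ (-(3 * (d : ℝ) / 2))) ^ 2 *
      (packetMass ε Θx * packetMass ε (conjMat Θy)) =
      (8 ^ d * Real.pi ^ (2 * d))⁻¹ / (ε ^ (2 * d) * √((reMat Θx).det * (reMat Θy).det)) := by
  have hdx := hx.det_pos
  have hdy := hy.det_pos
  rw [packetMass, packetMass, reMat_conjMat, Real.sqrt_mul hdx.le]
  have e1 : ((2 * Real.pi * ε) ^ (-(3 * (d : ℝ) / 2))) ^ 2 = ((2 * Real.pi * ε) ^ (3 * d))⁻¹ := by
    rw [← Real.rpow_natCast, ← Real.rpow_mul (by positivity), ← Real.rpow_natCast,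
      ← Real.rpow_neg (by positivity)]
    congr 1
    push_cast
    ring
  have e2 : (Real.pi * ε) ^ ((d : ℝ) / 2) * (Real.pi * ε) ^ ((d : ℝ) / 2) =
      (Real.pi * ε) ^ d := by
    rw [← Real.rpow_add (by positivity), ← Real.rpow_natCast]
    congr 1
    ring
  have e3 : ((2 * Real.pi * ε) ^ (3 * d)) =
      8 ^ d * Real.pi ^ (2 * d) * ε ^ (2 * d) * (Real.pi * ε) ^ d := by
    rw [pow_mul, pow_mul, pow_mul, ← mul_pow, ← mul_pow, ← mul_pow]
    ring_nf
  rw [e1, div_mul_div_comm, e2, e3]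
  have hsx : 0 < √(reMat Θx).det := Real.sqrt_pos.2 hdx
  have hsy : 0 < √(reMat Θy).det := Real.sqrt_pos.2 hdy
  field_simp

/-- The two Schur constants contribute (4πε)^{2d}, which cancels ε^{-2d} and leaves 16^d/8^d = 2^d
under the root. -/
lemma norm_packetOp_le (hε : 0 < ε) (hx : IsWidth Θx) (hy : IsWidth Θy) (hK : IsCompact K)
    (hκ : Continuous κ) (hκ' : ∀ G : Phase d → ℝ, ∫ z, G (κ z) = ∫ z, G z) (hS : Continuous S)
    (hu : Continuous u) {U : ℝ} (hU0 : 0 ≤ U) (hU : ∀ z, ‖u z‖ ≤ U) :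
    ‖packetOp κ S u K hε hx hy‖ ≤
      √(2 ^ d / √((reMat Θx).det * (reMat Θy).det)) * U := by
  have mx := packetMass_pos hε hx
  have my := packetMass_pos hε hy.conjMat
  set c := (2 * Real.pi * ε) ^ (-(3 * (d : ℝ) / 2)) with hc
  have hc0 : 0 < c := by positivity
  refine (norm_frameOp_le (U := c * U) hK (continuous_amplitude hS hu)
    ((continuous_packetLp hε hx).comp hκ) (continuous_packetLp hε hy.conjMat)
    (by positivity) (by positivity) (by positivity)
    (setIntegral_norm_inner_packetLp_le hε hx hκ')
    (setIntegral_norm_inner_packetLp_le (κ := id) hε hy.conjMat fun _ => rfl) fun z => ?_).trans ?_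
  · rw [norm_amplitude hε]
    gcongr
    exact hU z
  · rw [← mul_assoc]
    refine mul_le_mul_of_nonneg_right (le_of_eq ?_) hU0
    rw [← Real.sqrt_sq hc0.le, ← Real.sqrt_mul (by positivity)]
    congr 1
    have h := sq_prefactor_mul_packetMass hε hx hy
    have e1 : (4 * Real.pi * ε) ^ d * (4 * Real.pi * ε) ^ d =
        2 ^ d * (8 ^ d * Real.pi ^ (2 * d)) * ε ^ (2 * d) := by
      rw [← mul_assoc, pow_mul, pow_mul, ← mul_pow, ← mul_pow, ← mul_pow, ← mul_pow]
      ring_nf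
    calc _ = (c ^ 2 * (packetMass ε Θx * packetMass ε (conjMat Θy))) *
          ((4 * Real.pi * ε) ^ d * (4 * Real.pi * ε) ^ d) := by ring
      _ = _ := by
        rw [h, e1]
        field_simp

end Extension
end
end CplxPhaseOp

namespace CplxPhaseOp

noncomputable section

/-! ### Poincaré inequality and Sobolev norms -/

section Poincare

variable {d : ℕ} {F : Type*} [NormedAddCommGroup F] {f : Phase d → F} {z₀ : Phase d} {r : ℝ}

lemma bddAbove_range_norm (hf : Continuous f) (h0 : ∀ z ∉ Metric.closedBall z₀ r, f z = 0) :
    BddAbove (Set.range fun z => ‖f z‖) :=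
  hf.norm.bddAbove_range_of_hasCompactSupport
    (HasCompactSupport.intro (isCompact_closedBall z₀ r) fun z hz => by rw [h0 z hz, norm_zero])

variable [NormedSpace ℝ F]

lemma contDiff_pderiv (j : Fin d ⊕ Fin d) (hf : ContDiff ℝ ∞ f) : ContDiff ℝ ∞ (pderiv j f) :=
  (hf.fderiv_right (by simp)).clm_apply contDiff_const

lemma contDiff_iterate_pderiv (j : Fin d ⊕ Fin d) (hf : ContDiff ℝ ∞ f) (n : ℕ) :
    ContDiff ℝ ∞ ((pderiv j)^[n] f) := by
  induction n with
  | zero => exact hf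
  | succ n ih => rw [Function.iterate_succ_apply']; exact contDiff_pderiv j ih

lemma pderiv_eq_zero_of_notMem_closedBall (j : Fin d ⊕ Fin d)
    (h0 : ∀ z ∉ Metric.closedBall z₀ r, f z = 0) : ∀ z ∉ Metric.closedBall z₀ r,
      pderiv j f z = 0 := by
  intro z hz
  have h : f =ᶠ[nhds z] fun _ => 0 := by
    filter_upwards [Metric.isClosed_closedBall.isOpen_compl.mem_nhds hz] with w hw using h0 w hw
  simp [pderiv, h.fderiv_eq]

lemma iterate_pderiv_eq_zero_of_notMem_closedBall (j : Fin d ⊕ Fin d)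
    (h0 : ∀ z ∉ Metric.closedBall z₀ r, f z = 0) (n : ℕ) : ∀ z ∉ Metric.closedBall z₀ r,
      (pderiv j)^[n] f z = 0 := by
  induction n with
  | zero => exact h0
  | succ n ih =>
    rw [Function.iterate_succ_apply']
    exact pderiv_eq_zero_of_notMem_closedBall j ih

/-- Poincaré's inequality in one direction for functions supported in a ball. -/
lemma norm_le_of_norm_pderiv_le (j : Fin d ⊕ Fin d) (hr : 0 < r) (hf : Differentiable ℝ f)
    (h0 : ∀ z ∉ Metric.closedBall z₀ r, f z = 0) {M : ℝ} (hM : ∀ z, ‖pderiv j f z‖ ≤ M)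
    (z : Phase d) : ‖f z‖ ≤ 3 * r * M := by
  have hM0 : 0 ≤ M := (norm_nonneg _).trans (hM z)
  by_cases hz : z ∈ Metric.closedBall z₀ r
  · set e : Phase d := EuclideanSpace.single j 1 with he
    have hen : ‖e‖ = 1 := by simp [he]
    -- A displacement by 3r exceeds the diameter 2r, so it leaves the closed ball.
    have hz' : f (z + (3 * r) • e) = 0 := by
      apply h0
      rw [Metric.mem_closedBall, dist_eq_norm] at hz ⊢
      have h1 : (3 * r) • e = (z + (3 * r) • e - z₀) - (z - z₀) := by abel
      have h2 : ‖(3 * r) • e‖ = 3 * r := by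
        rw [norm_smul, hen, mul_one, Real.norm_of_nonneg (by positivity)]
      have h3 := norm_sub_le (z + (3 * r) • e - z₀) (z - z₀)
      rw [← h1, h2] at h3
      linarith
    have hd : ∀ t ∈ (Set.univ : Set ℝ), HasDerivWithinAt (fun t : ℝ => f (z + t • e))
        (pderiv j f (z + t • e)) Set.univ t := by
      intro t _
      have hg : HasDerivAt (fun t : ℝ => z + t • e) e t := by
        simpa using ((hasDerivAt_id t).smul_const e).const_add z
      exact ((hf _).hasFDerivAt.comp_hasDerivAt t hg).hasDerivWithinAt
    have h := convex_univ.norm_image_sub_le_of_norm_hasDerivWithin_le hd (fun t _ => hM _)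
      (Set.mem_univ (0 : ℝ)) (Set.mem_univ (3 * r))
    rw [hz', zero_smul, add_zero, zero_sub, norm_neg, sub_zero,
      Real.norm_of_nonneg (by positivity)] at h
    linarith
  · rw [h0 z hz, norm_zero]
    positivity

lemma norm_le_of_norm_iterate_pderiv_le (j : Fin d ⊕ Fin d) (hr : 0 < r) (n : ℕ) {M : ℝ} :
    ∀ {f : Phase d → F}, ContDiff ℝ ∞ f → (∀ z ∉ Metric.closedBall z₀ r, f z = 0) →
      (∀ z, ‖(pderiv j)^[n] f z‖ ≤ M) → ∀ z, ‖f z‖ ≤ (3 * r) ^ n * M := by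
  induction n with
  | zero => intro f _ _ hM z; simpa using hM z
  | succ n ih =>
    intro f hf h0 hM z
    have h1 := ih (contDiff_pderiv j hf) (pderiv_eq_zero_of_notMem_closedBall j h0) hM
    rw [pow_succ', mul_assoc]
    exact norm_le_of_norm_pderiv_le j hr (hf.differentiable (by simp)) h0 h1 z

lemma multiDeriv_zero (f : Phase d → F) : multiDeriv 0 f = f := by
  unfold multiDeriv
  induction ((List.finRange d).map Sum.inl ++ (List.finRange d).map Sum.inr :
    List (Fin d ⊕ Fin d)) with
  | nil => rfl
  | cons a l ih => simp

lemma foldr_pderiv_single_of_notMem {j : Fin d ⊕ Fin d} (n : ℕ) (f : Phase d → F)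
    {l : List (Fin d ⊕ Fin d)} (hj : j ∉ l) :
    l.foldr (fun i g => (pderiv i)^[(Pi.single j n : Fin d ⊕ Fin d → ℕ) i] g) f = f := by
  induction l with
  | nil => rfl
  | cons a l ih =>
    rw [List.mem_cons, not_or] at hj
    rw [List.foldr_cons, ih hj.2, Pi.single_eq_of_ne' hj.1]
    rfl

lemma foldr_pderiv_single {j : Fin d ⊕ Fin d} (n : ℕ) (f : Phase d → F)
    {l : List (Fin d ⊕ Fin d)} (hl : l.Nodup) (hj : j ∈ l) :
    l.foldr (fun i g => (pderiv i)^[(Pi.single j n : Fin d ⊕ Fin d → ℕ) i] g) f =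
      (pderiv j)^[n] f := by
  induction l with
  | nil => simp at hj
  | cons a l ih =>
    rw [List.nodup_cons] at hl
    rw [List.foldr_cons]
    by_cases h : j = a
    · subst h
      rw [foldr_pderiv_single_of_notMem n f hl.1, Pi.single_eq_same]
    · rw [ih hl.2 ((List.mem_cons.1 hj).resolve_left h), Pi.single_eq_of_ne' h]
      rfl

lemma multiDeriv_single (j : Fin d ⊕ Fin d) (n : ℕ) (f : Phase d → F) :
    multiDeriv (Pi.single j n) f = (pderiv j)^[n] f := by
  refine foldr_pderiv_single n f ?_ ?_
  · rw [List.nodup_append']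
    refine ⟨(List.nodup_finRange d).map Sum.inl_injective,
      (List.nodup_finRange d).map Sum.inr_injective, ?_⟩
    intro a ha hb
    simp only [List.mem_map] at ha hb
    obtain ⟨i, -, rfl⟩ := ha
    obtain ⟨i', -, h⟩ := hb
    exact Sum.inr_ne_inl h
  · rcases j with i | i <;> simp

/-- The term for α is one summand of a nonnegative sum. Boundedness matters because a real supremum
over an unbounded set is 0 by default. -/
lemma norm_multiDeriv_le_sobolevNorm {α : Fin d ⊕ Fin d → ℕ} {m : ℕ} (hα : ∑ i, α i ≤ m)
    (hb : BddAbove (Set.range fun z => ‖multiDeriv α f z‖)) (z : Phase d) :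
    ‖multiDeriv α f z‖ ≤ sobolevNorm m f := by
  have hnn : ∀ β : Fin d ⊕ Fin d → ℕ, 0 ≤ ⨆ z, ‖multiDeriv β f z‖ := fun β =>
    Real.iSup_nonneg fun _ => norm_nonneg _
  refine (le_ciSup hb z).trans ?_
  unfold sobolevNorm
  refine le_trans ?_ (Finset.single_le_sum (f := fun k =>
    ∑ α ∈ Finset.piAntidiag (Finset.univ : Finset (Fin d ⊕ Fin d)) k, ⨆ z, ‖multiDeriv α f z‖)
    (fun k _ => Finset.sum_nonneg fun β _ => hnn β) (Finset.mem_range_succ_iff.2 hα))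
  exact Finset.single_le_sum (f := fun α => ⨆ z, ‖multiDeriv α f z‖) (fun β _ => hnn β)
    (by simp [Finset.mem_piAntidiag])

lemma sobolevNorm_nonneg (m : ℕ) (f : Phase d → F) : 0 ≤ sobolevNorm m f :=
  Finset.sum_nonneg fun _ _ => Finset.sum_nonneg fun _ _ => Real.iSup_nonneg fun _ => norm_nonneg _

lemma norm_le_sobolevNorm (m : ℕ) (hf : Continuous f)
    (h0 : ∀ z ∉ Metric.closedBall z₀ r, f z = 0) (z : Phase d) : ‖f z‖ ≤ sobolevNorm m f := by
  have h := norm_multiDeriv_le_sobolevNorm (f := f) (α := 0) (m := m) (by simp)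
    (by rw [multiDeriv_zero]; exact bddAbove_range_norm hf h0) z
  rwa [multiDeriv_zero] at h

lemma norm_le_pow_mul_sobolevNorm (hr : 0 < r) (hf : ContDiff ℝ ∞ f)
    (h0 : ∀ z ∉ Metric.closedBall z₀ r, f z = 0) (z : Phase d) :
    ‖f z‖ ≤ (3 * r) ^ d * sobolevNorm (d + 1) f := by
  -- For d = 0 there is no coordinate to differentiate in, but the factor (3r)^d is then 1.
  rcases Nat.eq_zero_or_pos d with rfl | hd
  · simpa using norm_le_sobolevNorm (0 + 1) hf.continuous h0 z
  · set j : Fin d ⊕ Fin d := Sum.inl ⟨0, hd⟩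
    refine norm_le_of_norm_iterate_pderiv_le j hr d hf h0 (fun w => ?_) z
    rw [← multiDeriv_single]
    refine norm_multiDeriv_le_sobolevNorm (by simp) ?_ w
    rw [multiDeriv_single]
    exact bddAbove_range_norm (contDiff_iterate_pderiv j hf d).continuous
      (iterate_pderiv_eq_zero_of_notMem_closedBall j h0 d)

end Poincare
end
end CplxPhaseOp

namespace CplxPhaseOp

/-! ### Almost orthogonality from separated supports -/

section Separation

open MeasureTheory

variable {d : ℕ} {ε : ℝ} {Θ Θx Θy : Matrix (Fin d) (Fin d) ℂ} {κ : Phase d → Phase d}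
  {S : Phase d → ℝ} {u v : Phase d → ℂ} {K : Set (Phase d)}

lemma sepDist_nonneg (f : Phase d → Phase d) (K L : Set (Phase d)) : 0 ≤ sepDist f K L :=
  Real.sInf_nonneg (by rintro t ⟨a, -, b, -, rfl⟩; exact norm_nonneg _)

lemma sepDist_le {f : Phase d → Phase d} {K L : Set (Phase d)} {z w : Phase d} (hz : z ∈ K)
    (hw : w ∈ L) : sepDist f K L ≤ ‖f z - f w‖ :=
  csInf_le ⟨0, by rintro t ⟨a, -, b, -, rfl⟩; exact norm_nonneg _⟩
    ⟨f z, Set.mem_image_of_mem f hz, f w, Set.mem_image_of_mem f hw, rfl⟩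

lemma norm_inner_packetLp_le_sepDist (hε : 0 < ε) (hΘ : IsWidth Θ) {L : Set (Phase d)}
    {z w : Phase d} (hz : z ∈ K) (hw : w ∈ L) :
    ‖inner ℂ (packetLp hε hΘ (κ w)) (packetLp hε hΘ (κ z))‖ ≤
      packetMass ε Θ * Real.exp (-(sepDist (fun z => LamMap Θ (κ z)) K L) ^ 2 / (4 * ε)) := by
  have hm := packetMass_pos hε hΘ
  rw [norm_inner_packetLp, map_sub]
  gcongr
  · exact sepDist_nonneg _ _ _
  · exact sepDist_le (f := fun z => LamMap Θ (κ z)) hz hw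

lemma setIntegral_norm_amplitude (hε : 0 < ε) (huK : ∀ z ∉ K, u z = 0) :
    ∫ z in K, ‖amplitude ε S u z‖ = (2 * Real.pi * ε) ^ (-(3 * (d : ℝ) / 2)) * ∫ z, ‖u z‖ := by
  simp_rw [norm_amplitude hε]
  rw [integral_const_mul, setIntegral_eq_integral_of_forall_compl_eq_zero
    fun z hz => by rw [huK z hz, norm_zero]]

lemma mem_tsupport_of_amplitude_ne_zero {z : Phase d} (h : amplitude ε S u z ≠ 0) :
    z ∈ tsupport u :=
  subset_tsupport u fun h0 => h (by rw [amplitude, h0, mul_zero])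

/-- In this composition the inner product joins two `x`-packets, so Λ(Θ^x)∘κ measures the
separation; the `y`-packets enter only through their norm. -/
lemma norm_adjoint_packetOp_comp_le (hε : 0 < ε) (hx : IsWidth Θx) (hy : IsWidth Θy)
    (hK : IsCompact K) (hκ : Continuous κ) (hS : Continuous S) (hu : Continuous u)
    (hv : Continuous v) (huK : ∀ z ∉ K, u z = 0) (hvK : ∀ z ∉ K, v z = 0) :
    ‖ContinuousLinearMap.adjoint (packetOp κ S v K hε hx hy) ∘L packetOp κ S u K hε hx hy‖ ≤
      (8 ^ d * Real.pi ^ (2 * d))⁻¹ *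
        (Real.exp (-(sepDist (fun z => LamMap Θx (κ z)) (tsupport u) (tsupport v)) ^ 2 / (4 * ε)) *
          (∫ z, ‖u z‖) * (∫ z, ‖v z‖)) / (ε ^ (2 * d) * √((reMat Θx).det * (reMat Θy).det)) := by
  have mx := packetMass_pos hε hx
  have my := packetMass_pos hε hy.conjMat
  refine (norm_adjoint_frameOp_comp_le hK (continuous_amplitude hS hu) (continuous_amplitude hS hv)
    ((continuous_packetLp hε hx).comp hκ) (continuous_packetLp hε hy.conjMat)
    (norm_packetLp hε hy.conjMat) (by positivity) fun z w hz hw =>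
      norm_inner_packetLp_le_sepDist hε hx (mem_tsupport_of_amplitude_ne_zero hz)
        (mem_tsupport_of_amplitude_ne_zero hw)).trans (le_of_eq ?_)
  have h := sq_prefactor_mul_packetMass hε hx hy
  rw [setIntegral_norm_amplitude hε huK, setIntegral_norm_amplitude hε hvK, Real.sq_sqrt my.le,
    mul_div_right_comm (8 ^ d * Real.pi ^ (2 * d))⁻¹, ← h]
  ring

lemma norm_packetOp_comp_adjoint_le (hε : 0 < ε) (hx : IsWidth Θx) (hy : IsWidth Θy)
    (hK : IsCompact K) (hκ : Continuous κ) (hS : Continuous S) (hu : Continuous u)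
    (hv : Continuous v) (huK : ∀ z ∉ K, u z = 0) (hvK : ∀ z ∉ K, v z = 0) :
    ‖packetOp κ S v K hε hx hy ∘L ContinuousLinearMap.adjoint (packetOp κ S u K hε hx hy)‖ ≤
      (8 ^ d * Real.pi ^ (2 * d))⁻¹ *
        (Real.exp (-(sepDist (fun z => LamMap (conjMat Θy) z) (tsupport u) (tsupport v)) ^ 2 /
          (4 * ε)) *
          (∫ z, ‖u z‖) * (∫ z, ‖v z‖)) / (ε ^ (2 * d) * √((reMat Θx).det * (reMat Θy).det)) := by
  have mx := packetMass_pos hε hx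
  have my := packetMass_pos hε hy.conjMat
  have hg : Continuous fun z => packetLp hε hx (κ z) := (continuous_packetLp hε hx).comp hκ
  have hh := continuous_packetLp hε hy.conjMat
  have hau := continuous_amplitude (ε := ε) hS hu
  have hav := continuous_amplitude (ε := ε) hS hv
  -- The adjoints are superpositions with the packet families exchanged, so the overlaps are now
  -- those of `y`-packets, centred at z itself.
  rw [← ContinuousLinearMap.adjoint_adjoint (packetOp κ S v K hε hx hy), packetOp, packetOp,
    adjoint_frameOp hK hau hg hh, adjoint_frameOp hK hav hg hh]
  refine (norm_adjoint_frameOp_comp_le hK (Complex.continuous_conj.comp hau)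
    (Complex.continuous_conj.comp hav) hh hg
    (fun z => norm_packetLp hε hx (κ z)) (by positivity) fun z w hz hw =>
      norm_inner_packetLp_le_sepDist (κ := fun z => z) hε hy.conjMat
        (mem_tsupport_of_amplitude_ne_zero (ε := ε) (S := S) (u := u) fun h => hz (by simp [h]))
        (mem_tsupport_of_amplitude_ne_zero (ε := ε) (S := S) (u := v) fun h => hw (by simp [h]))).trans (le_of_eq ?_)
  have h := sq_prefactor_mul_packetMass hε hx hy
  simp only [Function.comp_apply, RCLike.norm_conj]
  rw [setIntegral_norm_amplitude hε huK, setIntegral_norm_amplitude hε hvK, Real.sq_sqrt mx.le,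
    mul_div_right_comm (8 ^ d * Real.pi ^ (2 * d))⁻¹, ← h]
  ring

lemma crossNorm_le {A B : L2 d →L[ℂ] L2 d} {a b : ℝ} (ha : ‖A‖ ≤ a) (hb : ‖B‖ ≤ b) :
    crossNorm A B ≤ 2 * (a * b) := by
  have hb0 : 0 ≤ b := (norm_nonneg _).trans hb
  have h1 := (ContinuousLinearMap.adjoint B).opNorm_comp_le A
  have h2 := B.opNorm_comp_le (ContinuousLinearMap.adjoint A)
  rw [LinearIsometryEquiv.norm_map] at h1 h2
  have h3 : ‖B‖ * ‖A‖ ≤ b * a := by gcongr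
  unfold crossNorm
  linarith

end Separation

end CplxPhaseOp

/-! ### The main theorem -/

theorem mainTheorem4 (d : ℕ) :
    -- `C` depends on `d` only; `C'` depends on `d`, on `M^κ_k` for `k ≤ d + 2`, on the norms of
    -- `Λ(Θ^x)`, `Λ(Θ^y)`, `Λ(Θ^x)⁻¹`, `Λ(Θ^y)⁻¹` and on `r_∞` only.
    ∃ C : ℝ, 0 < C ∧
    ∃ C' : (Fin (d + 3) → ℝ) → ℝ → ℝ → ℝ → ℝ → ℝ → ℝ, (∀ M a b a' b' R, 0 < C' M a b a' b' R) ∧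
    ∀ (κ : CplxPhaseOp.Phase d → CplxPhaseOp.Phase d) (S : CplxPhaseOp.Phase d → ℝ)
      (Θx Θy : Matrix (Fin d) (Fin d) ℂ) (u v : CplxPhaseOp.Phase d → ℂ),
      CplxPhaseOp.IsClassB κ → CplxPhaseOp.IsAction κ S →
      CplxPhaseOp.IsWidth Θx → CplxPhaseOp.IsWidth Θy →
      ContDiff ℝ ∞ u → HasCompactSupport u → ContDiff ℝ ∞ v → HasCompactSupport v →
      -- the operator extends uniquely to `L²`, with an `ε`-independent bound
      (∃ B : ℝ, ∀ ε : ℝ, 0 < ε → ε ≤ 1 → ∃ A : CplxPhaseOp.L2 d →L[ℂ] CplxPhaseOp.L2 d,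
        CplxPhaseOp.ExtendsToL2 (CplxPhaseOp.fio ε κ S Θx Θy u) A ∧
        (∀ A', CplxPhaseOp.ExtendsToL2 (CplxPhaseOp.fio ε κ S Θx Θy u) A' → A' = A) ∧
        ‖A‖ ≤ B) ∧
      ∀ ε : ℝ, 0 < ε → ε ≤ 1 → ∀ Iu Iv : CplxPhaseOp.L2 d →L[ℂ] CplxPhaseOp.L2 d,
        CplxPhaseOp.ExtendsToL2 (CplxPhaseOp.fio ε κ S Θx Θy u) Iu →
        CplxPhaseOp.ExtendsToL2 (CplxPhaseOp.fio ε κ S Θx Θy v) Iv →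
        -- (i)
        ‖ContinuousLinearMap.adjoint Iv ∘L Iu‖ ≤
          C * (Real.exp (-(CplxPhaseOp.sepDist (fun z => CplxPhaseOp.LamMap Θx (κ z))
                (tsupport u) (tsupport v)) ^ 2 / (4 * ε)) * (∫ z, ‖u z‖) * (∫ z, ‖v z‖)) /
            (ε ^ (2 * d) * √((CplxPhaseOp.reMat Θx).det * (CplxPhaseOp.reMat Θy).det)) ∧
        ‖Iv ∘L ContinuousLinearMap.adjoint Iu‖ ≤
          C * (Real.exp (-(CplxPhaseOp.sepDist
                (fun z => CplxPhaseOp.LamMap (CplxPhaseOp.conjMat Θy) z)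
                (tsupport u) (tsupport v)) ^ 2 / (4 * ε)) * (∫ z, ‖u z‖) * (∫ z, ‖v z‖)) /
            (ε ^ (2 * d) * √((CplxPhaseOp.reMat Θx).det * (CplxPhaseOp.reMat Θy).det)) ∧
        -- (ii)
        ∀ (z₀ : CplxPhaseOp.Phase d) (r rinf : ℝ), 0 < r → r ≤ rinf →
          tsupport u ∪ tsupport v ⊆ Metric.closedBall z₀ r →
          CplxPhaseOp.crossNorm Iu Iv ≤
            C' (fun k => CplxPhaseOp.boundM κ k) ‖CplxPhaseOp.LamMap Θx‖ ‖CplxPhaseOp.LamMap Θy‖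
                ‖CplxPhaseOp.LamInvMap Θx‖ ‖CplxPhaseOp.LamInvMap Θy‖ rinf * r ^ d *
              (CplxPhaseOp.sobolevNorm (d + 1) u * CplxPhaseOp.sobolevNorm (d + 1) v) /
              √((CplxPhaseOp.reMat Θx).det * (CplxPhaseOp.reMat Θy).det) := by
  -- In 2·6^d, the 2 counts the compositions in `crossNorm`, 2^d is the product of the two operator
  -- bounds, and 3^d comes from Poincaré's inequality.
  refine ⟨(8 ^ d * Real.pi ^ (2 * d))⁻¹, by positivity, fun _ _ _ _ _ _ => 2 * 6 ^ d,
    fun _ _ _ _ _ _ => by positivity, ?_⟩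
  intro κ S Θx Θy u v hκ hS hx hy hu hu' hv hv'
  have hκc := hκ.smooth.continuous
  have hκi := hκ.toIsCanonical.integral_comp
  have hSc := hS.differentiable.continuous
  refine ⟨?_, ?_⟩
  · obtain ⟨U, hU⟩ := hu'.exists_bound_of_continuous hu.continuous
    have hU0 : 0 ≤ U := (norm_nonneg _).trans (hU 0)
    refine ⟨_, fun ε hε _ => ⟨CplxPhaseOp.packetOp κ S u (tsupport u) hε hx hy, ?_, ?_,
      CplxPhaseOp.norm_packetOp_le hε hx hy hu' hκc hκi hSc hu.continuous hU0 hU⟩⟩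
    · exact CplxPhaseOp.extendsToL2_packetOp hε hx hy hu' hκc hSc hu.continuous
        fun z hz => image_eq_zero_of_notMem_tsupport hz
    · intro A' hA'
      exact hA'.unique (CplxPhaseOp.extendsToL2_packetOp hε hx hy hu' hκc hSc hu.continuous
        fun z hz => image_eq_zero_of_notMem_tsupport hz)
  · intro ε hε _ Iu Iv hIu hIv
    have hK : IsCompact (tsupport u ∪ tsupport v) := hu'.isCompact.union hv'.isCompact
    have huK : ∀ z ∉ tsupport u ∪ tsupport v, u z = 0 := fun z hz =>
      image_eq_zero_of_notMem_tsupport fun h => hz (Or.inl h)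
    have hvK : ∀ z ∉ tsupport u ∪ tsupport v, v z = 0 := fun z hz =>
      image_eq_zero_of_notMem_tsupport fun h => hz (Or.inr h)
    -- By uniqueness any extension is the packet superposition, here over one compact set common to
    -- both symbols, as the composition bounds require.
    obtain rfl := hIu.unique
      (CplxPhaseOp.extendsToL2_packetOp hε hx hy hK hκc hSc hu.continuous huK)
    obtain rfl := hIv.unique
      (CplxPhaseOp.extendsToL2_packetOp hε hx hy hK hκc hSc hv.continuous hvK)
    refine ⟨CplxPhaseOp.norm_adjoint_packetOp_comp_le hε hx hy hK hκc hSc hu.continuous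
      hv.continuous huK hvK, CplxPhaseOp.norm_packetOp_comp_adjoint_le hε hx hy hK hκc hSc
      hu.continuous hv.continuous huK hvK, ?_⟩
    intro z₀ r rinf hr _ hball
    have hu0 : ∀ z ∉ Metric.closedBall z₀ r, u z = 0 := fun z hz => huK z fun h => hz (hball h)
    have hv0 : ∀ z ∉ Metric.closedBall z₀ r, v z = 0 := fun z hz => hvK z fun h => hz (hball h)
    have hsu := CplxPhaseOp.sobolevNorm_nonneg (d + 1) u
    have hsv := CplxPhaseOp.sobolevNorm_nonneg (d + 1) v
    -- Poincaré's inequality is applied to `u` only, giving exactly r^d; for `v` the supremum bound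
    -- suffices.
    refine (CplxPhaseOp.crossNorm_le
      (CplxPhaseOp.norm_packetOp_le hε hx hy hK hκc hκi hSc hu.continuous (by positivity)
        (CplxPhaseOp.norm_le_pow_mul_sobolevNorm hr hu hu0))
      (CplxPhaseOp.norm_packetOp_le hε hx hy hK hκc hκi hSc hv.continuous hsv
        (CplxPhaseOp.norm_le_sobolevNorm (d + 1) hv.continuous hv0))).trans (le_of_eq ?_)
    rw [mul_mul_mul_comm, Real.mul_self_sqrt (by positivity), mul_pow,
      show (6 : ℝ) ^ d = 2 ^ d * 3 ^ d by rw [← mul_pow]; norm_num]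
    ring
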